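/- Let $n\ge 0$, $h\ge 1$, and let $u_{s,I}$ stand for $\partial^{s+|I|}u/\partial t^s\partial x_1^{i_1}\cdots\partial x_n^{i_n}$. Consider a scalar equation $$\frac{\partial^h u}{\partial t^h}=F$$ for $u=u(t,x_1,\dots,x_n)$, where $F$ is a smooth function of $t$, $x_j$, finitely many space derivatives $u_{0,I}$ (including $u$), and the pure time derivatives $u_{s,0}$, $s<h$. Let $U$ be the domain of $F$, an open set (for example, everything) in the space with coordinates $t,\ x_j,\ u_{s,I}$ ($0\le s<h$, $I\in\mathbb Z_{\ge0}^n$). All functions below are smooth functions on $U$ of finitely many of these coordinates. Let $D_{x_i}=\partial_{x_i}+\sum_{s,I}u_{s,I+1_i}\partial_{u_{s,I}}$ and $$D_t=\partial_t+\sum_{I,\,s<h-1}u_{s+1,I}\,\partial_{u_{s,I}}+\sum_I D_x^I(F)\,\partial_{u_{h-1,I}}$$ be the total derivatives restricted to the equation. The order $\mathrm o(f)$ of a function $f$ is the largest $k$ such that $\partial f/\partial u_{s,I}\not\equiv 0$ for some $s<h$ and some $I$ with $|I|=k$, and $\mathrm o(f)=-1$ if there is none. A conserved current is a tuple $J=(J_0,\dots,J_n)$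 with $D_tJ_0+\sum_i D_{x_i}J_i=0$. Writing $D_0=D_t$ and $D_i=D_{x_i}$, a current is trivial if $J_k=\sum_{l<k}D_l\mathcal L_{lk}-\sum_{k<l}D_l\mathcal L_{kl}$ for some functions $\mathcal L_{kl}$, $k<l$. A conservation law is an equivalence class of conserved currents modulo trivial ones, and its order is the order of its characteristic $$\chi=\sum_I(-1)^{|I|}D_x^I\Bigl(\frac{\partial J_0}{\partial u_{h-1,I}}\Bigr).$$ Put $N=\mathrm o(F)$ and assume that $N>0$ and that the symbol $A=\sum_{|I|=N}\frac{\partial F}{\partial u_{0,I}}q^I$ (a polynomial in $q_1,\dots,q_n$ whose coefficients are functions on $U$) does not vanish identically on any nonempty open subset of $U$; this is automatic if $F$ is analytic and $U$ is connected. By the Leibniz rule, write $$\sum_I(-1)^{|I|}D_x^I\circ\frac{\partial F}{\partial u_{0,I}}+\sum_{s=1}^{h-1}(-1)^sD_t^s\circ\frac{\partial F}{\partial u_{s,0}}=\sum_{|I|\le N}f_I\,D_x^I+\sum_{s=1}^{h-1}g_s\,D_t^s ,$$ and let $O=\max_{I,s}\{-1,\ \mathrm o(f_I)-N,\ \mathrm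 o(g_s)-N\}$. If $N+h$ is odd, then the equation has no conservation laws of order greater than $O$. -/

import Mathlib

open scoped ContDiff

noncomputable section

namespace GenEvolution

/-- Coordinates on the infinite prolongation of a scalar equation `∂ʰu/∂tʰ = F` in the independent
variables `t, x₁, …, xₙ`: the variables `t`, `xⱼ` and the derivatives
`u_{s,I} = ∂^{s+|I|} u / ∂tˢ∂x^I` with `s < h` and `I` a multi-index. -/
inductive JetVar (n h : ℕ) : Type
  | t : JetVar n h
  | x (j : Fin n) : JetVar n h
  | u (s : Fin h) (I : Fin n → ℕ) : JetVar n h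
  deriving DecidableEq

/-- Points of the infinite prolongation; it carries the product topology. -/
abbrev JetSpace (n h : ℕ) : Type := JetVar n h → ℝ

variable {n h : ℕ}

/-- The length `|I| = i₁ + ⋯ + iₙ` of a multi-index. -/
def len (I : Fin n → ℕ) : ℕ := ∑ i, I i

/-- `f` is, on `U`, a smooth function of finitely many of the coordinates. -/
def SmoothOn (U : Set (JetSpace n h)) (f : JetSpace n h → ℝ) : Prop :=
  ∃ (S : Finset (JetVar n h)) (g : (S → ℝ) → ℝ),
    ContDiffOn ℝ ∞ g ((fun p : JetSpace n h => S.restrict p) '' U) ∧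
      ∀ p ∈ U, f p = g (S.restrict p)

/-- The partial derivative `∂f/∂v` with respect to the coordinate `v`. -/
def pd (v : JetVar n h) (f : JetSpace n h → ℝ) : JetSpace n h → ℝ :=
  fun p => deriv (fun c : ℝ => f (Function.update p v c)) (p v)

/-- The total derivative `D_{x_i} = ∂/∂x_i + ∑_{s,I} u_{s,I+1_i} ∂/∂u_{s,I}`. For a function of
finitely many coordinates the sum is finite. -/
def Dx (i : Fin n) (f : JetSpace n h → ℝ) : JetSpace n h → ℝ :=
  fun p => pd (.x i) f p +
    ∑ᶠ v : Fin h × (Fin n → ℕ), p (.u v.1 (v.2 + Pi.single i 1)) * pd (.u v.1 v.2) f p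

/-- `D_x^I = D_{x_1}^{i_1} ⋯ D_{x_n}^{i_n}`. -/
def DxPow (I : Fin n → ℕ) (f : JetSpace n h → ℝ) : JetSpace n h → ℝ :=
  (List.finRange n).foldr (fun i g => (Dx i)^[I i] g) f

/-- The value of `∂u_{s,I}/∂t` on the equation `∂ʰu/∂tʰ = F`: it is `u_{s+1,I}` for `s < h - 1` and
`D_x^I F` for `s = h - 1`. -/
def timeDerivCoord (F : JetSpace n h → ℝ) (s : Fin h) (I : Fin n → ℕ) : JetSpace n h → ℝ :=
  fun p => if hs : (s : ℕ) + 1 < h then p (.u ⟨(s : ℕ) + 1, hs⟩ I) else DxPow I F p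

/-- The total derivative `D_t` restricted to the equation `∂ʰu/∂tʰ = F`. -/
def Dt (F : JetSpace n h → ℝ) (f : JetSpace n h → ℝ) : JetSpace n h → ℝ :=
  fun p => pd .t f p +
    ∑ᶠ v : Fin h × (Fin n → ℕ), timeDerivCoord F v.1 v.2 p * pd (.u v.1 v.2) f p

/-- All total derivatives: number `0` is `D_t`, number `i + 1` is `D_{x_i}`. -/
def Dtot (F : JetSpace n h → ℝ) (k : Fin (n + 1)) (f : JetSpace n h → ℝ) : JetSpace n h → ℝ :=
  Fin.cases (Dt F f) (fun i => Dx i f) k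

/-- The order of `f` on `U`: the largest `k` such that `∂f/∂u_{s,I}` is not identically zero for some
`s < h` and some `I` with `|I| = k`, and `-1` if there is none. -/
def order (U : Set (JetSpace n h)) (f : JetSpace n h → ℝ) : ℤ :=
  sSup {k : ℤ | k = -1 ∨
    ∃ (s : Fin h) (I : Fin n → ℕ), k = (len I : ℤ) ∧ ∃ p ∈ U, pd (.u s I) f p ≠ 0}

/-- A conserved current on `U`: an `(n+1)`-tuple `(J₀, J₁, …, Jₙ)` of smooth functions with
`D_t J₀ + ∑ D_{x_i} J_i = 0`. -/
def IsConservedCurrent (U : Set (JetSpace n h)) (F : JetSpace n h → ℝ)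
    (J : Fin (n + 1) → JetSpace n h → ℝ) : Prop :=
  (∀ k, SmoothOn U (J k)) ∧ ∀ p ∈ U, ∑ k, Dtot F k (J k) p = 0

/-- A trivial current on `U`: `J_k = ∑_{l<k} D_l 𝓛_{lk} - ∑_{k<l} D_l 𝓛_{kl}`. -/
def IsTrivialCurrent (U : Set (JetSpace n h)) (F : JetSpace n h → ℝ)
    (J : Fin (n + 1) → JetSpace n h → ℝ) : Prop :=
  ∃ L : Fin (n + 1) → Fin (n + 1) → JetSpace n h → ℝ,
    (∀ k l, k < l → SmoothOn U (L k l)) ∧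
      ∀ k, ∀ p ∈ U, J k p =
        ∑ l ∈ Finset.univ.filter (· < k), Dtot F l (L l k) p -
          ∑ l ∈ Finset.univ.filter (k < ·), Dtot F l (L k l) p

/-- A conservation law on `U`: an equivalence class of conserved currents modulo trivial ones. -/
def IsConservationLaw (U : Set (JetSpace n h)) (F : JetSpace n h → ℝ)
    (C : Set (Fin (n + 1) → JetSpace n h → ℝ)) : Prop :=
  ∃ J, IsConservedCurrent U F J ∧
    C = {J' | IsConservedCurrent U F J' ∧ IsTrivialCurrent U F (J' - J)}

/-- The characteristic `χ = ∑_I (-1)^{|I|} D_x^I (∂J₀/∂u_{h-1,I})` of a current `J`. -/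
def characteristic (hh : 0 < h) (J : Fin (n + 1) → JetSpace n h → ℝ) : JetSpace n h → ℝ :=
  fun p => ∑ᶠ I : Fin n → ℕ,
    (-1 : ℝ) ^ len I * DxPow I (pd (.u ⟨h - 1, Nat.sub_one_lt_of_lt hh⟩ I) (J 0)) p

/-- `k` is the order of the conservation law `C`, that is, of the characteristic of a current
representing it. -/
def LawHasOrder (hh : 0 < h) (U : Set (JetSpace n h)) (C : Set (Fin (n + 1) → JetSpace n h → ℝ))
    (k : ℤ) : Prop :=
  ∃ J ∈ C, order U (characteristic hh J) = k

/-!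
The adjoint linearization of `F` is the operator
`L = ∑_I (-1)^{|I|} D_x^I ∘ ∂F/∂u_{0,I} + ∑_{1 ≤ r < h} (-1)^r D_t^r ∘ ∂F/∂u_{r,0}`.
Moving the derivations to the right by the Leibniz rule, one gets
`L = ∑_K f_K D_x^K + ∑_{1 ≤ s < h} g_s D_t^s` with the coefficients below.
-/

/-- The coefficient of `D_t^s` in `∑_{1 ≤ r < h} (-1)^r D_t^r ∘ ∂F/∂u_{r,0}`. -/
def timeCoeff (F : JetSpace n h → ℝ) (s : ℕ) : JetSpace n h → ℝ :=
  fun p => ∑ r ∈ Finset.univ.filter (fun r : Fin h => 1 ≤ (r : ℕ)),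
    (-1 : ℝ) ^ (r : ℕ) * ((r : ℕ).choose s : ℝ) * (Dt F)^[(r : ℕ) - s] (pd (.u r 0) F) p

/-- The coefficient `f_K` of `D_x^K` in `L`; the free term `f_0` of `L` gets contributions from both
sums. -/
def spaceCoeff (hh : 0 < h) (F : JetSpace n h → ℝ) (K : Fin n → ℕ) : JetSpace n h → ℝ :=
  fun p => (∑ᶠ I : Fin n → ℕ,
    (-1 : ℝ) ^ len I * ((∏ i, (I i).choose (K i) : ℕ) : ℝ) *
      DxPow (I - K) (pd (.u ⟨0, hh⟩ I) F) p) + if K = 0 then timeCoeff F 0 p else 0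

/-- The number `O`: the maximum of `-1`, of `o(f_K) - N` for `|K| ≤ N` and of `o(g_s) - N` for
`1 ≤ s < h`. -/
def boundO (hh : 0 < h) (U : Set (JetSpace n h)) (F : JetSpace n h → ℝ) (N : ℕ) : ℤ :=
  sSup {k : ℤ | k = -1 ∨
    (∃ K : Fin n → ℕ, len K ≤ N ∧ k = order U (spaceCoeff hh F K) - N) ∨
      ∃ s : ℕ, 1 ≤ s ∧ s < h ∧ k = order U (timeCoeff F s) - N}

/-- The set of points of `U` at which the symbol `A = ∑_{|I|=N} (∂F/∂u_{0,I}) q^I` of the right-hand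
side is a nonzero polynomial in `q₁, …, qₙ`. -/
def symbolNonzero (hh : 0 < h) (U : Set (JetSpace n h)) (F : JetSpace n h → ℝ) (N : ℕ) :
    Set (JetSpace n h) :=
  {p ∈ U | ∃ I : Fin n → ℕ, len I = N ∧ pd (.u ⟨0, hh⟩ I) F p ≠ 0}

end GenEvolution

end

open scoped ContDiff

noncomputable section

namespace GenEvolution

variable {n h : ℕ}

/-! The characteristic `χ` of a conserved current solves the adjoint linearized equation `(-1)^h
D_t^h χ = L χ`, where `L` is the adjoint linearization of `F` (`adjoint_equation`). Suppose that `χ`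
has order `k > O`. Let `c` be the largest `s` such that `χ` depends on some `u_{s,J}` with `|J| =
k`, and let `σ = ∑_{|J|=k} (∂χ/∂u_{c,J}) q^J`. The contradiction comes from differentiating the
equation with respect to `u_{c,I}`, `|I| = k + N`.

On the left, `h - 1 - c` time derivatives raise `u_{c,J}` to `u_{h-1,J}`. The next one replaces it
by `D_x^J F`, whose top part is `∑_{|K|=N} (∂F/∂u_{0,K}) u_{0,J+K}`, and the remaining `c` raise
this to level `c`. The result is the coefficient of `q^I` in `(-1)^h A σ` (`du_DtPow_top`). On the
right, fewer than `h` time derivatives cannot reach level `c` at length `k + N`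
(`du_DtPow_eq_zero`), and the coefficients of `L` do not involve variables of that length, because
`k > O`. Only the terms `f_K D_x^K` with `|K| = N` remain, where `f_K = (-1)^N ∂F/∂u_{0,K}`, and
they give `(-1)^N A σ`. As `N + h` is odd, `2 A σ = 0` (`symbol_mul_eq_zero`). But `σ ≠ 0` on a
nonempty open set, which contains a point with `A ≠ 0`, and real polynomials have no zero divisors.

The algebra is carried out in an abstract `JetAlgebra`, free of differentiability side conditions.
Smooth functions on `U` form one (`smoothJetAlgebra`), and `Represents` links its operations to the
concrete ones. -/

/-! ### Calculus of smooth functions of finitely many coordinates -/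

/-- Openness of the projected domain turns `ContDiffOn` there into honest differentiability at each
point. -/
theorem isOpen_restrict_image {U : Set (JetSpace n h)} (hU : IsOpen U) (S : Finset (JetVar n h)) :
    IsOpen ((fun p : JetSpace n h => S.restrict p) '' U) := by
  rw [isOpen_iff_mem_nhds]
  rintro _ ⟨p, hp, rfl⟩
  -- A continuous section of the projection through `p`: the coordinates outside `S` are frozen at
  -- their values at `p`.
  let e : (S → ℝ) → JetSpace n h := fun q v => if hv : v ∈ S then q ⟨v, hv⟩ else p v
  have he : Continuous e := by
    refine continuous_pi fun v => ?_
    by_cases hv : v ∈ S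
    · simpa [e, hv] using continuous_apply _
    · simpa [e, hv] using continuous_const
  have hep : e (S.restrict p) = p := by
    funext v
    by_cases hv : v ∈ S <;> simp [e, hv]
  have hmem : e ⁻¹' U ∈ nhds (S.restrict p) :=
    he.continuousAt.preimage_mem_nhds (by rw [hep]; exact hU.mem_nhds hp)
  refine Filter.mem_of_superset hmem fun q hq => ⟨e q, hq, ?_⟩
  funext v
  simp [e]

theorem eventually_update_mem {U : Set (JetSpace n h)} (hU : IsOpen U) {p : JetSpace n h}
    (hp : p ∈ U) (v : JetVar n h) : ∀ᶠ c in nhds (p v), Function.update p v c ∈ U := by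
  have hc : Continuous fun c : ℝ => Function.update p v c := continuous_const.update v continuous_id
  exact hc.continuousAt.preimage_mem_nhds (by simpa using hU.mem_nhds hp)

theorem pd_congr {U : Set (JetSpace n h)} (hU : IsOpen U) {f f' : JetSpace n h → ℝ}
    (hf : ∀ p ∈ U, f p = f' p) (v : JetVar n h) : ∀ p ∈ U, pd v f p = pd v f' p := by
  intro p hp
  refine Filter.EventuallyEq.deriv_eq ?_
  filter_upwards [eventually_update_mem hU hp v] with c hc using hf _ hc

/-- The coordinate vector of `v` in the space of the coordinates from `S`; it is zero if `v ∉ S`. -/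
def coordVec (S : Finset (JetVar n h)) (v : JetVar n h) : S → ℝ :=
  fun w => if (w : JetVar n h) = v then 1 else 0

theorem hasDerivAt_restrict_update (S : Finset (JetVar n h)) (v : JetVar n h) (p : JetSpace n h) :
    HasDerivAt (fun c : ℝ => S.restrict (Function.update p v c)) (coordVec S v) (p v) := by
  rw [hasDerivAt_pi]
  rintro ⟨w, hw⟩
  by_cases hwv : w = v
  · subst hwv
    simpa [coordVec] using hasDerivAt_id' (p w)
  · simpa [coordVec, hwv] using hasDerivAt_const (p v) (p w)

theorem hasDerivAt_update {U : Set (JetSpace n h)} (hU : IsOpen U) {f : JetSpace n h → ℝ}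
    {S : Finset (JetVar n h)} {g : (S → ℝ) → ℝ}
    (hg : ContDiffOn ℝ ∞ g ((fun p : JetSpace n h => S.restrict p) '' U))
    (hf : ∀ p ∈ U, f p = g (S.restrict p)) (v : JetVar n h) {p : JetSpace n h} (hp : p ∈ U) :
    HasDerivAt (fun c : ℝ => f (Function.update p v c))
      (fderiv ℝ g (S.restrict p) (coordVec S v)) (p v) := by
  have hgd : DifferentiableAt ℝ g (S.restrict p) :=
    (hg.contDiffAt ((isOpen_restrict_image hU S).mem_nhds ⟨p, hp, rfl⟩)).differentiableAt (by simp)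
  have hgd' : HasFDerivAt g (fderiv ℝ g (S.restrict p))
      (S.restrict (Function.update p v (p v))) := by
    simpa using hgd.hasFDerivAt
  refine (hgd'.comp_hasDerivAt (p v) (hasDerivAt_restrict_update S v p)).congr_of_eventuallyEq ?_
  filter_upwards [eventually_update_mem hU hp v] with c hc using hf _ hc

theorem contDiffOn_fderiv_apply {U : Set (JetSpace n h)} (hU : IsOpen U) {S : Finset (JetVar n h)}
    {g : (S → ℝ) → ℝ} (hg : ContDiffOn ℝ ∞ g ((fun p : JetSpace n h => S.restrict p) '' U))
    (d : S → ℝ) :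
    ContDiffOn ℝ ∞ (fun q => fderiv ℝ g q d) ((fun p : JetSpace n h => S.restrict p) '' U) :=
  (hg.fderiv_of_isOpen (isOpen_restrict_image hU S) (by simp)).clm_apply contDiffOn_const

namespace SmoothOn

variable {U : Set (JetSpace n h)} {f f' : JetSpace n h → ℝ}

theorem congr (hf : SmoothOn U f) (hff : ∀ p ∈ U, f' p = f p) : SmoothOn U f' := by
  obtain ⟨S, g, hg, hfg⟩ := hf
  exact ⟨S, g, hg, fun p hp => (hff p hp).trans (hfg p hp)⟩

/-- Allowing every larger coordinate set lets two functions be written over the union of theirs. -/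
theorem exists_of_subset (hf : SmoothOn U f) : ∃ S : Finset (JetVar n h), ∀ T, S ⊆ T →
    ∃ g : (T → ℝ) → ℝ, ContDiffOn ℝ ∞ g ((fun p : JetSpace n h => T.restrict p) '' U) ∧
      ∀ p ∈ U, f p = g (T.restrict p) := by
  obtain ⟨S, g, hg, hfg⟩ := hf
  refine ⟨S, fun T hST => ⟨fun q => g (fun v => q ⟨v, hST v.2⟩), ?_, fun p hp => hfg p hp⟩⟩
  refine hg.comp (contDiff_pi.2 fun v => contDiff_apply ℝ ℝ _).contDiffOn ?_
  rintro _ ⟨p, hp, rfl⟩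
  exact ⟨p, hp, rfl⟩

theorem exists_common (hf : SmoothOn U f) (hf' : SmoothOn U f') :
    ∃ (S : Finset (JetVar n h)) (g g' : (S → ℝ) → ℝ),
      ContDiffOn ℝ ∞ g ((fun p : JetSpace n h => S.restrict p) '' U) ∧
      ContDiffOn ℝ ∞ g' ((fun p : JetSpace n h => S.restrict p) '' U) ∧
      (∀ p ∈ U, f p = g (S.restrict p)) ∧ ∀ p ∈ U, f' p = g' (S.restrict p) := by
  obtain ⟨S, hS⟩ := hf.exists_of_subset
  obtain ⟨S', hS'⟩ := hf'.exists_of_subset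
  obtain ⟨g, hg, hfg⟩ := hS (S ∪ S') Finset.subset_union_left
  obtain ⟨g', hg', hfg'⟩ := hS' (S ∪ S') Finset.subset_union_right
  exact ⟨_, g, g', hg, hg', hfg, hfg'⟩

theorem add (hf : SmoothOn U f) (hf' : SmoothOn U f') : SmoothOn U (fun p => f p + f' p) := by
  obtain ⟨S, g, g', hg, hg', hfg, hfg'⟩ := hf.exists_common hf'
  exact ⟨S, fun q => g q + g' q, hg.add hg', fun p hp => by simp only [hfg p hp, hfg' p hp]⟩

theorem mul (hf : SmoothOn U f) (hf' : SmoothOn U f') : SmoothOn U (fun p => f p * f' p) := by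
  obtain ⟨S, g, g', hg, hg', hfg, hfg'⟩ := hf.exists_common hf'
  exact ⟨S, fun q => g q * g' q, hg.mul hg', fun p hp => by simp only [hfg p hp, hfg' p hp]⟩

theorem const (c : ℝ) : SmoothOn U fun _ => c :=
  ⟨∅, fun _ => c, contDiffOn_const, fun _ _ => rfl⟩

theorem coord (v : JetVar n h) : SmoothOn U fun p => p v :=
  ⟨{v}, fun q => q ⟨v, by simp⟩, (contDiff_apply ℝ ℝ _).contDiffOn, fun _ _ => rfl⟩

theorem pd (hU : IsOpen U) (hf : SmoothOn U f) (v : JetVar n h) : SmoothOn U (pd v f) := by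
  obtain ⟨S, g, hg, hfg⟩ := hf
  exact ⟨S, _, contDiffOn_fderiv_apply hU hg (coordVec S v),
    fun p hp => (hasDerivAt_update hU hg hfg v hp).deriv⟩

theorem differentiableAt (hU : IsOpen U) (hf : SmoothOn U f) (v : JetVar n h) {p : JetSpace n h}
    (hp : p ∈ U) : DifferentiableAt ℝ (fun c : ℝ => f (Function.update p v c)) (p v) := by
  obtain ⟨S, g, hg, hfg⟩ := hf
  exact (hasDerivAt_update hU hg hfg v hp).differentiableAt

theorem continuousOn (hf : SmoothOn U f) : ContinuousOn f U := by
  obtain ⟨S, g, hg, hfg⟩ := hf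
  refine ContinuousOn.congr (hg.continuousOn.comp (f := fun p : JetSpace n h => S.restrict p) ?_
    fun p hp => ⟨p, hp, rfl⟩) hfg
  exact (continuous_pi fun v => continuous_apply _).continuousOn

theorem pd_comm (hU : IsOpen U) (hf : SmoothOn U f) (v w : JetVar n h) {p : JetSpace n h}
    (hp : p ∈ U) :
    GenEvolution.pd v (GenEvolution.pd w f) p = GenEvolution.pd w (GenEvolution.pd v f) p := by
  obtain ⟨S, g, hg, hfg⟩ := hf
  have hpd : ∀ v, ∀ p ∈ U, GenEvolution.pd v f p = fderiv ℝ g (S.restrict p) (coordVec S v) :=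
    fun v p hp => (hasDerivAt_update hU hg hfg v hp).deriv
  have hga : ContDiffAt ℝ ∞ g (S.restrict p) :=
    hg.contDiffAt ((isOpen_restrict_image hU S).mem_nhds ⟨p, hp, rfl⟩)
  have hdd : DifferentiableAt ℝ (fderiv ℝ g) (S.restrict p) :=
    (hga.fderiv_right (m := 1) (by norm_cast)).differentiableAt (by simp)
  have key : ∀ v w, GenEvolution.pd v (GenEvolution.pd w f) p =
      fderiv ℝ (fderiv ℝ g) (S.restrict p) (coordVec S v) (coordVec S w) := by
    intro v w
    have h1 := (hasDerivAt_update hU (contDiffOn_fderiv_apply hU hg (coordVec S w)) (hpd w) v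
      hp).deriv
    refine h1.trans ?_
    rw [fderiv_clm_apply hdd (by fun_prop)]
    simp
  rw [key v w, key w v]
  exact (hga.isSymmSndFDerivAt (by simp; norm_cast)).eq _ _

theorem exists_pd_eq_zero (hU : IsOpen U) (hf : SmoothOn U f) : ∃ S : Finset (JetVar n h),
    ∀ v ∉ S, ∀ p ∈ U, GenEvolution.pd v f p = 0 := by
  obtain ⟨S, g, hg, hfg⟩ := hf
  refine ⟨S, fun v hv p hp => (hasDerivAt_update hU hg hfg v hp).deriv.trans ?_⟩
  have : coordVec S v = 0 := by
    funext w
    have : (w : JetVar n h) ≠ v := fun hw => hv (hw ▸ w.2)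
    simp [coordVec, this]
  simp [this]

end SmoothOn

/-! ### Jet algebras and the algebra of smooth functions on `U` -/

/-- A commutative algebra with the differential structure of the algebra of smooth functions of
finitely many jet coordinates. -/
structure JetAlgebra (n h : ℕ) (R : Type*) [CommRing R] [Algebra ℝ R] where
  /-- The partial derivatives. -/
  der : JetVar n h → Derivation ℝ R R
  /-- The coordinate functions. -/
  X : JetVar n h → R
  der_comm : ∀ v w f, der v (der w f) = der w (der v f)
  der_X : ∀ v w, der v (X w) = if v = w then 1 else 0
  finite_der : ∀ f, {v | der v f ≠ 0}.Finite

/-- The smooth functions on `U` of finitely many coordinates. -/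
def smoothAlg (U : Set (JetSpace n h)) : Subalgebra ℝ (U → ℝ) where
  carrier := {f | ∃ g, SmoothOn U g ∧ ∀ p : U, f p = g p}
  mul_mem' := by
    rintro _ _ ⟨g, hg, hfg⟩ ⟨g', hg', hfg'⟩
    exact ⟨_, hg.mul hg', fun p => by simp [hfg, hfg']⟩
  add_mem' := by
    rintro _ _ ⟨g, hg, hfg⟩ ⟨g', hg', hfg'⟩
    exact ⟨_, hg.add hg', fun p => by simp [hfg, hfg']⟩
  algebraMap_mem' c := ⟨_, .const c, fun p => rfl⟩

section smoothAlg

variable {U : Set (JetSpace n h)}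

/-- The restriction of a smooth function to `U`. -/
def SmoothOn.toAlg {f : JetSpace n h → ℝ} (hf : SmoothOn U f) : smoothAlg U :=
  ⟨fun p => f p, f, hf, fun _ => rfl⟩

/-- A smooth function on the whole space with given restriction to `U`. -/
def extend (r : smoothAlg U) : JetSpace n h → ℝ := r.2.choose

theorem smoothOn_extend (r : smoothAlg U) : SmoothOn U (extend r) := r.2.choose_spec.1

theorem extend_apply (r : smoothAlg U) (p : U) : r.1 p = extend r p := r.2.choose_spec.2 p

/-- The jet algebra of smooth functions on `U`. -/
def smoothJetAlgebra (hU : IsOpen U) : JetAlgebra n h (smoothAlg U) where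
  der v := Derivation.mk'
    { toFun := fun r => ((smoothOn_extend r).pd hU v).toAlg
      map_add' := fun r r' => by
        ext p
        refine (pd_congr (f' := fun p => extend r p + extend r' p) hU (fun p hp => ?_) v p
          p.2).trans ?_
        · rw [← extend_apply _ ⟨p, hp⟩, ← extend_apply _ ⟨p, hp⟩, ← extend_apply _ ⟨p, hp⟩]
          rfl
        · exact deriv_add ((smoothOn_extend r).differentiableAt hU v p.2)
            ((smoothOn_extend r').differentiableAt hU v p.2)
      map_smul' := fun c r => by
        ext p
        refine (pd_congr (f' := fun p => c * extend r p) hU (fun p hp => ?_) v p p.2).trans ?_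
        · rw [← extend_apply _ ⟨p, hp⟩, ← extend_apply _ ⟨p, hp⟩]
          rfl
        · exact deriv_const_mul c ((smoothOn_extend r).differentiableAt hU v p.2) }
    (fun r r' => by
      ext p
      refine (pd_congr (f' := fun p => extend r p * extend r' p) hU (fun p hp => ?_) v p
        p.2).trans ?_
      · rw [← extend_apply _ ⟨p, hp⟩, ← extend_apply _ ⟨p, hp⟩, ← extend_apply _ ⟨p, hp⟩]
        rfl
      · refine (deriv_mul ((smoothOn_extend r).differentiableAt hU v p.2)
            ((smoothOn_extend r').differentiableAt hU v p.2)).trans ?_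
        simp only [Function.update_eq_self, ← extend_apply]
        change _ = r.1 p * pd v (extend r') p + r'.1 p * pd v (extend r) p
        simp only [pd]
        ring)
  X v := (SmoothOn.coord v).toAlg
  der_comm v w r := by
    ext p
    have h1 : ∀ v w, pd v (extend (((smoothOn_extend r).pd hU w).toAlg)) p =
        pd v (pd w (extend r)) p := fun v w =>
      pd_congr hU (fun p hp => (extend_apply _ ⟨p, hp⟩).symm) v p p.2
    exact (h1 v w).trans (((smoothOn_extend r).pd_comm hU v w p.2).trans (h1 w v).symm)
  der_X v w := by
    ext p
    refine (pd_congr hU (fun p hp => (extend_apply (SmoothOn.coord w).toAlg ⟨p, hp⟩).symm) v p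
      p.2).trans ?_
    by_cases hvw : v = w
    · subst hvw
      simp [pd]
    · simp [pd, Function.update_of_ne (Ne.symm hvw), hvw]
  finite_der r := by
    obtain ⟨S, hS⟩ := (smoothOn_extend r).exists_pd_eq_zero hU
    refine S.finite_toSet.subset fun v hv => ?_
    by_contra hvS
    exact hv (by ext p; exact hS v hvS p p.2)

theorem smoothJetAlgebra_der_apply (hU : IsOpen U) (v : JetVar n h) {f : JetSpace n h → ℝ}
    {r : smoothAlg U} (hfr : ∀ p : U, f p = r.1 p) (p : U) :
    pd v f p = ((smoothJetAlgebra hU).der v r).1 p :=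
  pd_congr hU (fun p hp => (hfr ⟨p, hp⟩).trans (extend_apply _ _)) v p p.2

end smoothAlg

/-! ### Multi-indices and powers of commuting operators -/

theorem multiIndex_induction {P : (Fin n → ℕ) → Prop} (zero : P 0)
    (add_single : ∀ I i, P I → P (I + Pi.single i 1)) (I : Fin n → ℕ) : P I := by
  suffices ∀ m (I : Fin n → ℕ), len I = m → P I from this _ I rfl
  intro m
  induction m with
  | zero =>
    intro I hI
    have : I = 0 := by
      funext i
      exact (Finset.sum_eq_zero_iff.1 hI) i (Finset.mem_univ i)
    exact this ▸ zero
  | succ m ih =>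
    intro I hI
    obtain ⟨i, -, hi⟩ : ∃ i ∈ Finset.univ, I i ≠ 0 :=
      Finset.exists_ne_zero_of_sum_ne_zero (by unfold len at hI; omega)
    have hle : Pi.single i 1 ≤ I := by
      intro j
      by_cases hj : j = i
      · subst hj; simpa using Nat.one_le_iff_ne_zero.2 hi
      · simp [hj]
    have hadd : I - Pi.single i 1 + Pi.single i 1 = I := tsub_add_cancel_of_le hle
    rw [← hadd]
    refine add_single _ _ (ih _ ?_)
    have : len (I - Pi.single i 1 + Pi.single i 1) = m + 1 := by rw [hadd, hI]
    simpa [len, Finset.sum_add_distrib] using this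

theorem len_add (I J : Fin n → ℕ) : len (I + J) = len I + len J := Finset.sum_add_distrib

theorem len_single (i : Fin n) : len (Pi.single i 1) = 1 := by simp [len]

theorem len_zero : len (0 : Fin n → ℕ) = 0 := by simp [len]

theorem single_le_iff {I : Fin n → ℕ} {i : Fin n} : Pi.single i 1 ≤ I ↔ 1 ≤ I i := by
  refine ⟨fun hI => by simpa using hI i, fun hI j => ?_⟩
  by_cases hj : j = i
  · subst hj; simpa using hI
  · simp [hj]

theorem finsum_ite_sub_single {M : Type*} [AddCommMonoid M] (i : Fin n)
    (ψ : (Fin n → ℕ) → M) :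
    ∑ᶠ I : Fin n → ℕ, (if 1 ≤ I i then ψ (I - Pi.single i 1) else 0) = ∑ᶠ I, ψ I := by
  have hinj : Function.Injective fun I : Fin n → ℕ => I + Pi.single i 1 := add_left_injective _
  have h1 := finsum_mem_range (f := fun I : Fin n → ℕ =>
    if 1 ≤ I i then ψ (I - Pi.single i 1) else 0) hinj
  simp only [Pi.add_apply, Pi.single_eq_same, le_add_iff_nonneg_left, zero_le, if_true,
    add_tsub_cancel_right] at h1
  rw [← h1]
  refine finsum_congr fun I => ?_
  by_cases hI : 1 ≤ I i
  · have : I ∈ Set.range fun I : Fin n → ℕ => I + Pi.single i 1 :=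
      ⟨_, tsub_add_cancel_of_le (single_le_iff.2 hI)⟩
    simp only [this, finsum_true]
  · simp [hI]

/-- The product of the powers `a_i ^ I_i`. -/
def multiPow {M : Type*} [Monoid M] (a : Fin n → M) (I : Fin n → ℕ) : M :=
  ((List.finRange n).map fun i => a i ^ I i).prod

theorem multiPow_zero {M : Type*} [Monoid M] (a : Fin n → M) : multiPow a 0 = 1 := by
  simp [multiPow]

theorem commute_multiPow {M : Type*} [Monoid M] {a : Fin n → M} {b : M}
    (hb : ∀ i, Commute b (a i)) (I : Fin n → ℕ) : Commute b (multiPow a I) := by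
  refine Commute.list_prod_right _ _ fun x hx => ?_
  obtain ⟨i, -, rfl⟩ := List.mem_map.1 hx
  exact (hb i).pow_right _

theorem multiPow_add_single {M : Type*} [Monoid M] {a : Fin n → M}
    (ha : ∀ i j, Commute (a i) (a j)) (I : Fin n → ℕ) (i : Fin n) :
    multiPow a (I + Pi.single i 1) = a i * multiPow a I := by
  suffices ∀ l : List (Fin n), l.Nodup →
      (l.map fun j => a j ^ (I + Pi.single i 1 : Fin n → ℕ) j).prod =
        (if i ∈ l then a i else 1) * (l.map fun j => a j ^ I j).prod by
    simpa [multiPow] using this _ (List.nodup_finRange n)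
  intro l hl
  induction l with
  | nil => simp
  | cons j l ih =>
    rw [List.nodup_cons] at hl
    rw [List.map_cons, List.prod_cons, ih hl.2, List.map_cons, List.prod_cons]
    by_cases hij : i = j
    · subst hij
      simp [hl.1, pow_succ', mul_assoc]
    · have hji : j ≠ i := Ne.symm hij
      by_cases hil : i ∈ l
      · simp only [hil, List.mem_cons, or_true, if_true, Pi.add_apply, Pi.single_eq_of_ne hji,
          add_zero, ← mul_assoc]
        rw [((ha i j).pow_right _).eq]
      · simp [hil, hij, hji]

theorem multiPow_end_apply {M : Type*} [AddCommGroup M] [Module ℝ M]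
    (D : Fin n → Module.End ℝ M) (I : Fin n → ℕ) (f : M) :
    multiPow D I f = (List.finRange n).foldr (fun i g => (D i)^[I i] g) f := by
  unfold multiPow
  induction List.finRange n with
  | nil => simp
  | cons i l ih =>
    rw [List.map_cons, List.prod_cons, Module.End.mul_apply, ih, Module.End.pow_apply]
    rfl

/-! ### Higher Leibniz rules -/

section Leibniz

variable {R : Type*} [CommRing R] [Algebra ℝ R]

theorem derivation_pow_mul (D : Derivation ℝ R R) (r : ℕ) (a b : R) :
    ((D : Module.End ℝ R) ^ r) (a * b) = ∑ j ∈ Finset.range (r + 1),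
      (r.choose j : ℝ) • (((D : Module.End ℝ R) ^ (r - j)) a * ((D : Module.End ℝ R) ^ j) b) := by
  induction r with
  | zero => simp
  | succ r ih =>
    have hD : ∀ j c, D (((D : Module.End ℝ R) ^ j) c) = ((D : Module.End ℝ R) ^ (j + 1)) c := by
      intro j c
      rw [pow_succ', Module.End.mul_apply]
      rfl
    rw [pow_succ', Module.End.mul_apply, ih, map_sum]
    have := Finset.sum_choose_succ_nsmul (fun j k =>
      ((D : Module.End ℝ R) ^ k) a * ((D : Module.End ℝ R) ^ j) b) r
    simp only [← Nat.cast_smul_eq_nsmul ℝ] at this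
    rw [this, ← Finset.sum_add_distrib]
    refine Finset.sum_congr rfl fun j hj => ?_
    have hj' : r + 1 - j = r - j + 1 := by
      have := Finset.mem_range.1 hj
      omega
    rw [map_smul, hj', ← smul_add]
    congr 1
    change D _ = _
    rw [D.leibniz, hD, hD, smul_eq_mul, smul_eq_mul]
    ring

/-- Pascal's rule in the `i`-th factor; the other factors are unaffected. -/
theorem prod_choose_add_single (I K : Fin n → ℕ) (i : Fin n) :
    ∏ j, ((I + Pi.single i 1 : Fin n → ℕ) j).choose (K j) =
      ∏ j, (I j).choose (K j) +
        if 1 ≤ K i then ∏ j, (I j).choose ((K - Pi.single i 1 : Fin n → ℕ) j) else 0 := by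
  have hsplit : ∀ φ : Fin n → ℕ, ∏ j, φ j = φ i * ∏ j ∈ Finset.univ.erase i, φ j :=
    fun φ => (Finset.mul_prod_erase _ _ (Finset.mem_univ i)).symm
  have h1 : ∏ j ∈ Finset.univ.erase i, ((I + Pi.single i 1 : Fin n → ℕ) j).choose (K j) =
      ∏ j ∈ Finset.univ.erase i, (I j).choose (K j) :=
    Finset.prod_congr rfl fun j hj => by simp [(Finset.mem_erase.1 hj).1]
  have h2 : ∏ j ∈ Finset.univ.erase i, (I j).choose ((K - Pi.single i 1 : Fin n → ℕ) j) =
      ∏ j ∈ Finset.univ.erase i, (I j).choose (K j) :=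
    Finset.prod_congr rfl fun j hj => by simp [(Finset.mem_erase.1 hj).1]
  rw [hsplit, hsplit, hsplit, h1, h2]
  rcases Nat.eq_zero_or_pos (K i) with hK | hK
  · simp [hK]
  · obtain ⟨m, hm⟩ := Nat.exists_eq_succ_of_ne_zero hK.ne'
    simp [hm, Nat.choose_succ_succ]
    ring

theorem prod_choose_eq_zero {I K : Fin n → ℕ} (hK : ¬ K ≤ I) : ∏ j, (I j).choose (K j) = 0 := by
  simp only [Pi.le_def, not_forall, not_le] at hK
  obtain ⟨j, hj⟩ := hK
  exact Finset.prod_eq_zero (Finset.mem_univ j) (Nat.choose_eq_zero_of_lt hj)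

theorem multiPow_derivation_mul {D : Fin n → Derivation ℝ R R}
    (hD : ∀ i j, Commute (D i : Module.End ℝ R) (D j)) (I : Fin n → ℕ) (a b : R) :
    multiPow (fun i => (D i : Module.End ℝ R)) I (a * b) = ∑ K ∈ Finset.Iic I,
      ((∏ j, (I j).choose (K j) : ℕ) : ℝ) •
        (multiPow (fun i => (D i : Module.End ℝ R)) (I - K) a *
          multiPow (fun i => (D i : Module.End ℝ R)) K b) := by
  set P := multiPow (fun i => (D i : Module.End ℝ R)) with hP
  have hs : ∀ J i c, D i (P J c) = P (J + Pi.single i 1) c := by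
    intro J i c
    rw [hP, multiPow_add_single hD]
    rfl
  induction I using multiIndex_induction with
  | zero =>
    have h0 : Finset.Iic (0 : Fin n → ℕ) = {0} := by
      ext K
      simp
    simp [h0, hP, multiPow_zero]
  | add_single I i ih =>
    rw [← hs, ih, map_sum]
    simp only [prod_choose_add_single, Nat.cast_add, add_smul, Finset.sum_add_distrib]
    have hsub : Finset.Iic I ⊆ Finset.Iic (I + Pi.single i 1) :=
      Finset.Iic_subset_Iic.2 le_self_add
    have e1 : ∑ K ∈ Finset.Iic (I + Pi.single i 1), ((∏ j, (I j).choose (K j) : ℕ) : ℝ) •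
        (P (I + Pi.single i 1 - K) a * P K b) =
        ∑ K ∈ Finset.Iic I, ((∏ j, (I j).choose (K j) : ℕ) : ℝ) •
          (P (I - K + Pi.single i 1) a * P K b) := by
      rw [← Finset.sum_subset hsub]
      · refine Finset.sum_congr rfl fun K hK => ?_
        rw [tsub_add_eq_add_tsub (Finset.mem_Iic.1 hK)]
      · intro K _ hK
        rw [prod_choose_eq_zero (by simpa using hK)]
        simp
    have e2 : ∑ K ∈ Finset.Iic (I + Pi.single i 1),
        (((if 1 ≤ K i then ∏ j, (I j).choose ((K - Pi.single i 1 : Fin n → ℕ) j) else 0 : ℕ)) : ℝ) •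
        (P (I + Pi.single i 1 - K) a * P K b) =
        ∑ K ∈ Finset.Iic I, ((∏ j, (I j).choose (K j) : ℕ) : ℝ) •
          (P (I - K) a * P (K + Pi.single i 1) b) := by
      symm
      refine Finset.sum_bij_ne_zero (fun K _ _ => K + Pi.single i 1) ?_ ?_ ?_ ?_
      · intro K hK _
        simpa using hK
      · intro K _ _ K' _ _ hKK
        exact add_left_injective _ hKK
      · intro K hK hne
        have hKi : 1 ≤ K i := by
          by_contra hKi
          simp [hKi] at hne
        refine ⟨K - Pi.single i 1, ?_, ?_, tsub_add_cancel_of_le (single_le_iff.2 hKi)⟩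
        · simpa [tsub_le_iff_right] using hK
        · rw [tsub_add_cancel_of_le (single_le_iff.2 hKi), tsub_tsub_eq_add_tsub_of_le
            (single_le_iff.2 hKi)]
          simpa only [hKi, if_true] using hne
      · intro K hK _
        simp [add_tsub_add_eq_tsub_right]
    rw [e1, e2, ← Finset.sum_add_distrib]
    refine Finset.sum_congr rfl fun K hK => ?_
    rw [Derivation.map_smul, ← smul_add, Derivation.leibniz, hs, hs, smul_eq_mul, smul_eq_mul]
    congr 1
    ring

end Leibniz

/-- Applying `(-1)^s T^s` to the `s`-th relation and summing cancels every `p s` except the last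
one. This eliminates all unknowns but the characteristic. -/
theorem telescope_adjoint {M : Type*} [AddCommGroup M] [Module ℝ M] (hh : 0 < h)
    (T : Module.End ℝ M) (p a : Fin h → M)
    (hp : ∀ s : Fin h, T (p s) +
      (if 1 ≤ (s : ℕ) then p ⟨s - 1, lt_of_le_of_lt (Nat.sub_le _ _) s.2⟩ else 0) + a s = 0) :
    (-1 : ℝ) ^ h • (T ^ h) (p ⟨h - 1, Nat.sub_one_lt_of_lt hh⟩) =
      ∑ s : Fin h, (-1 : ℝ) ^ (s : ℕ) • (T ^ (s : ℕ)) (a s) := by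
  obtain ⟨m, rfl⟩ : ∃ m, h = m + 1 := ⟨h - 1, by omega⟩
  have ha : ∀ s, a s = -T (p s) -
      (if 1 ≤ (s : ℕ) then p ⟨s - 1, lt_of_le_of_lt (Nat.sub_le _ _) s.2⟩ else 0) := by
    intro s
    rw [eq_neg_of_add_eq_zero_right (hp s)]
    abel
  have hT : ∀ (j : ℕ) x, (T ^ j) (T x) = (T ^ (j + 1)) x := fun j x => by
    rw [pow_succ, Module.End.mul_apply]
  simp only [ha, map_sub, map_neg, hT, smul_sub, Finset.sum_sub_distrib]
  rw [Fin.sum_univ_castSucc, Fin.sum_univ_succ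
    (fun s : Fin (m + 1) => (-1 : ℝ) ^ (s : ℕ) • (T ^ (s : ℕ)) _)]
  have hl : (⟨m + 1 - 1, Nat.sub_one_lt_of_lt hh⟩ : Fin (m + 1)) = Fin.last m := by
    ext; simp
  rw [hl]
  have hc : ∀ s : Fin m, (⟨(s.succ : ℕ) - 1, lt_of_le_of_lt (Nat.sub_le _ _) s.succ.2⟩ :
      Fin (m + 1)) = s.castSucc := fun s => by ext; simp
  simp only [hc]
  simp [pow_succ, Finset.sum_neg_distrib]

/-! ### Total derivatives, adjoints and the adjoint equation -/

namespace JetAlgebra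

variable {R : Type*} [CommRing R] [Algebra ℝ R] (A : JetAlgebra n h R)

/-- The partial derivative with respect to `u_{s,I}`. -/
def du (v : Fin h × (Fin n → ℕ)) : Derivation ℝ R R := A.der (.u v.1 v.2)

theorem finite_du (f : R) : {v | A.du v f ≠ 0}.Finite :=
  (A.finite_der f).preimage (f := fun v : Fin h × (Fin n → ℕ) => JetVar.u v.1 v.2) fun v _ w _ hvw => by
    simpa [Prod.ext_iff] using hvw

theorem exists_multiIndex_support (f : R) :
    ∃ B : Finset (Fin n → ℕ), ∀ I ∉ B, ∀ s, A.du (s, I) f = 0 := by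
  refine ⟨(A.finite_du f).toFinset.image Prod.snd, fun I hI s => ?_⟩
  by_contra hne
  exact hI (Finset.mem_image.2 ⟨(s, I), by simpa using hne, rfl⟩)

theorem du_comm (v w : Fin h × (Fin n → ℕ)) (f : R) : A.du v (A.du w f) = A.du w (A.du v f) :=
  A.der_comm _ _ f

/-- The vector field `∂/∂e + ∑ a_v ∂/∂u_v`. -/
def field (e : JetVar n h) (a : Fin h × (Fin n → ℕ) → R) : Derivation ℝ R R :=
  have hfin : ∀ f, (Function.support fun v => a v * A.du v f).Finite := fun f =>
    (A.finite_du f).subset fun v hv => right_ne_zero_of_mul hv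
  Derivation.mk'
    { toFun := fun f => A.der e f + ∑ᶠ v, a v * A.du v f
      map_add' := fun f g => by
        simp only [map_add, mul_add]
        rw [finsum_add_distrib (hfin f) (hfin g)]
        abel
      map_smul' := fun c f => by
        simp only [Derivation.map_smul, mul_smul_comm, RingHom.id_apply, smul_add]
        rw [smul_finsum] }
    (fun f g => by
      have h1 : ∀ c f, c * (∑ᶠ v, a v * A.du v f) = ∑ᶠ v, c * (a v * A.du v f) :=
        fun c f => mul_finsum' _ _ (hfin f)
      have h2 : ∀ c f, (Function.support fun v => c * (a v * A.du v f)).Finite := fun c f =>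
        (hfin f).subset fun v hv => right_ne_zero_of_mul hv
      change A.der e (f * g) + ∑ᶠ v, a v * A.du v (f * g) =
        f * (A.der e g + ∑ᶠ v, a v * A.du v g) + g * (A.der e f + ∑ᶠ v, a v * A.du v f)
      rw [mul_add, mul_add, h1, h1, add_add_add_comm, ← finsum_add_distrib (h2 _ _) (h2 _ _),
        Derivation.leibniz, smul_eq_mul, smul_eq_mul]
      congr 1
      refine finsum_congr fun v => ?_
      rw [Derivation.leibniz, smul_eq_mul, smul_eq_mul]
      ring)

variable (e e' : JetVar n h) (a b : Fin h × (Fin n → ℕ) → R)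

theorem field_apply (f : R) : A.field e a f = A.der e f + ∑ᶠ v, a v * A.du v f := rfl

theorem field_eq_sum {f : R} {T : Finset (Fin h × (Fin n → ℕ))}
    (hT : ∀ v ∉ T, A.du v f = 0) : A.field e a f = A.der e f + ∑ v ∈ T, a v * A.du v f := by
  rw [field_apply, finsum_eq_sum_of_support_subset]
  intro v hv
  by_contra hvT
  exact hv (by simp [hT v hvT])

theorem der_field (w : JetVar n h) (f : R) :
    A.der w (A.field e a f) = A.field e a (A.der w f) + ∑ᶠ v, A.der w (a v) * A.du v f := by
  have hT : ∀ v ∉ (A.finite_du f).toFinset, A.du v f = 0 := fun v hv => by simpa using hv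
  have hT' : ∀ v ∉ (A.finite_du f).toFinset, A.du v (A.der w f) = 0 := fun v hv => by
    rw [du, A.der_comm, ← du, hT v hv, map_zero]
  rw [A.field_eq_sum e a hT, A.field_eq_sum e a hT', map_add, map_sum, A.der_comm,
    finsum_eq_sum_of_support_subset (s := (A.finite_du f).toFinset), add_assoc,
    ← Finset.sum_add_distrib]
  · congr 1
    refine Finset.sum_congr rfl fun v _ => ?_
    rw [Derivation.leibniz, smul_eq_mul, smul_eq_mul, du, A.der_comm w]
    ring
  · intro v hv
    by_contra hvT
    exact hv (by simp [hT v hvT])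

/-- In the commutator of two such fields the second-order terms cancel, since partial derivatives
commute. What is left is a first-order operator whose coefficients are the differences of the two
sides of `hab`. -/
theorem field_comm (hab : ∀ v, A.field e a (b v) = A.field e' b (a v)) (f : R) :
    A.field e a (A.field e' b f) = A.field e' b (A.field e a f) := by
  set T := (A.finite_du f).toFinset with hTdef
  have hT : ∀ v ∉ T, A.du v f = 0 := fun v hv => by simpa [hTdef] using hv
  -- Apart from the first sum over `T`, this expansion is symmetric under exchanging `(e, a)` and
  -- `(e', b)`.
  have key : ∀ (e e' : JetVar n h) (a b : Fin h × (Fin n → ℕ) → R),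
      A.field e a (A.field e' b f) = A.der e (A.der e' f) + ∑ v ∈ T, A.field e a (b v) * A.du v f +
        (∑ v ∈ T, b v * A.der e (A.du v f) + ∑ v ∈ T, a v * A.der e' (A.du v f)) +
          ∑ v ∈ T, ∑ w ∈ T, a v * b w * A.du v (A.du w f) := by
    intro e e' a b
    have hT' : ∀ v ∉ T, A.du v (A.field e' b f) = ∑ w ∈ T, A.du v (b w) * A.du w f := by
      intro v hv
      have h0 := hT v hv
      rw [du] at h0
      rw [du, A.der_field, h0, map_zero, zero_add,
        finsum_eq_sum_of_support_subset (s := T)]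
      · intro w hw
        by_contra hwT
        exact hw (by simp [hT w hwT])
    have hTw : ∀ w, ∀ v ∉ T, A.du v (A.du w f) = 0 := fun w v hv => by
      rw [A.du_comm, hT v hv, map_zero]
    rw [A.field_eq_sum e' b hT, map_add, map_sum]
    have hTe : ∀ v ∉ T, A.du v (A.der e' f) = 0 := fun v hv => by
      rw [du, A.der_comm, ← du, hT v hv, map_zero]
    rw [A.field_eq_sum e a hTe]
    have h1 : ∀ w ∈ T, A.field e a (b w * A.du w f) = A.field e a (b w) * A.du w f +
        b w * A.der e (A.du w f) + ∑ v ∈ T, a v * b w * A.du v (A.du w f) := by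
      intro w _
      rw [Derivation.leibniz, smul_eq_mul, smul_eq_mul, A.field_eq_sum e a (hTw w), mul_add,
        Finset.mul_sum, mul_comm (A.du w f), add_comm, ← add_assoc]
      congr 1
      refine Finset.sum_congr rfl fun v _ => by ring
    have h2 : ∀ v ∈ T, a v * A.du v (A.der e' f) = a v * A.der e' (A.du v f) := by
      intro v _
      rw [du, A.der_comm]
    rw [Finset.sum_congr rfl h1, Finset.sum_congr rfl h2, Finset.sum_add_distrib,
      Finset.sum_add_distrib, Finset.sum_comm (s := T) (t := T)]
    abel
  rw [key e e' a b, key e' e b a, Finset.sum_comm (s := T) (t := T), A.der_comm e e']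
  simp only [hab]
  rw [add_comm (∑ v ∈ T, b v * A.der e (A.du v f))]
  congr 1
  refine Finset.sum_congr rfl fun v _ => Finset.sum_congr rfl fun w _ => ?_
  rw [A.du_comm]
  ring

theorem field_X (he : ∀ s I, e ≠ .u s I) (v : Fin h × (Fin n → ℕ)) :
    A.field e a (A.X (.u v.1 v.2)) = a v := by
  rw [field_apply, A.der_X, if_neg (he _ _), zero_add, finsum_eq_single _ v]
  · simp [du, A.der_X]
  · intro w hw
    rw [du, A.der_X, if_neg, mul_zero]
    intro hwv
    simp only [JetVar.u.injEq] at hwv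
    exact hw (Prod.ext hwv.1 hwv.2)

/-- The total derivative with respect to `x_i`. -/
def Dx (i : Fin n) : Derivation ℝ R R :=
  A.field (.x i) fun v => A.X (.u v.1 (v.2 + Pi.single i 1))

/-- The iterated total derivative `D_x^I`. -/
def DxPow (I : Fin n → ℕ) : Module.End ℝ R := multiPow (fun i => (A.Dx i : Module.End ℝ R)) I

/-- The value of the time derivative of `u_{s,I}` on the equation. -/
def timeDerivCoord (F : R) (v : Fin h × (Fin n → ℕ)) : R :=
  if hs : (v.1 : ℕ) + 1 < h then A.X (.u ⟨(v.1 : ℕ) + 1, hs⟩ v.2) else A.DxPow v.2 F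

/-- The total time derivative restricted to the equation. -/
def Dt (F : R) : Derivation ℝ R R := A.field .t (A.timeDerivCoord F)

theorem Dx_comm (i j : Fin n) (f : R) : A.Dx i (A.Dx j f) = A.Dx j (A.Dx i f) := by
  refine A.field_comm _ _ _ _ (fun v => ?_) f
  rw [A.field_X _ _ (by simp) (v.1, v.2 + Pi.single j 1),
    A.field_X _ _ (by simp) (v.1, v.2 + Pi.single i 1), add_right_comm]

theorem commute_Dx (i j : Fin n) : Commute (A.Dx i : Module.End ℝ R) (A.Dx j) :=
  LinearMap.ext fun f => A.Dx_comm i j f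

theorem DxPow_zero (f : R) : A.DxPow 0 f = f := by simp [DxPow, multiPow_zero]

theorem DxPow_add_single (I : Fin n → ℕ) (i : Fin n) (f : R) :
    A.DxPow (I + Pi.single i 1) f = A.Dx i (A.DxPow I f) := by
  rw [DxPow, multiPow_add_single A.commute_Dx]
  rfl

theorem Dx_DxPow (I : Fin n → ℕ) (i : Fin n) (f : R) :
    A.Dx i (A.DxPow I f) = A.DxPow I (A.Dx i f) :=
  LinearMap.congr_fun (commute_multiPow (fun j => A.commute_Dx i j) I).eq f

/-- By `field_comm` it suffices to compare the two derivatives of each `u_{s,I}`. The only case that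
is not a shift of indices is `s = h - 1`, where both equal `D_x^{I+1_i} F`. -/
theorem Dx_Dt (F : R) (i : Fin n) (f : R) : A.Dx i (A.Dt F f) = A.Dt F (A.Dx i f) := by
  refine A.field_comm _ _ _ _ (fun v => ?_) f
  rw [A.field_X _ _ (by simp) (v.1, v.2 + Pi.single i 1)]
  by_cases hs : (v.1 : ℕ) + 1 < h
  · simp only [timeDerivCoord, hs, dif_pos]
    exact A.field_X _ _ (by simp) (⟨(v.1 : ℕ) + 1, hs⟩, v.2)
  · simp only [timeDerivCoord, hs, dif_neg, not_false_eq_true]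
    exact (A.DxPow_add_single _ _ _).symm

theorem Dt_DxPow (F : R) (I : Fin n → ℕ) (f : R) :
    A.Dt F (A.DxPow I f) = A.DxPow I (A.Dt F f) :=
  LinearMap.congr_fun (commute_multiPow (b := (A.Dt F : Module.End ℝ R))
    (fun j => LinearMap.ext fun f => (A.Dx_Dt F j f).symm) I).eq f

theorem du_Dx (s : Fin h) (I : Fin n → ℕ) (i : Fin n) (f : R) :
    A.du (s, I) (A.Dx i f) = A.Dx i (A.du (s, I) f) +
      if 1 ≤ I i then A.du (s, I - Pi.single i 1) f else 0 := by
  rw [du, Dx, A.der_field]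
  congr 1
  simp only [A.der_X, JetVar.u.injEq, ite_mul, one_mul, zero_mul]
  split_ifs with hI
  · rw [finsum_eq_single _ (s, I - Pi.single i 1)]
    · simp [tsub_add_cancel_of_le (single_le_iff.2 hI)]
    · rintro ⟨s', J⟩ hne
      rw [if_neg]
      rintro ⟨rfl, hIJ⟩
      exact hne (by simp only at hIJ; rw [hIJ, add_tsub_cancel_right])
  · refine (finsum_congr fun v => if_neg ?_).trans finsum_zero
    rintro ⟨-, hIJ⟩
    exact hI (by rw [hIJ]; simp)

/-- The commutator of `∂/∂u_{s,I}` with `D_t` comes from differentiating the coefficients of `D_t`: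
the shift `u_{s-1,I} ↦ u_{s,I}` gives the second term, and the coefficients `D_x^J F` at level `h -
1` give the third. -/
theorem du_Dt (hh : 0 < h) (F : R) (s : Fin h) (I : Fin n → ℕ) (f : R) :
    A.du (s, I) (A.Dt F f) = A.Dt F (A.du (s, I) f) +
      (if 1 ≤ (s : ℕ) then A.du (⟨s - 1, lt_of_le_of_lt (Nat.sub_le _ _) s.2⟩, I) f else 0) +
      ∑ᶠ J, A.du (s, I) (A.DxPow J F) * A.du (⟨h - 1, Nat.sub_one_lt_of_lt hh⟩, J) f := by
  rw [du, Dt, A.der_field, add_assoc]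
  congr 1
  obtain ⟨B, hB⟩ := A.exists_multiIndex_support f
  rw [finsum_eq_sum_of_support_subset (s := Finset.univ ×ˢ B), Finset.sum_product,
    finsum_eq_sum_of_support_subset (s := B),
    ← Finset.sum_erase_add _ _ (Finset.mem_univ (⟨h - 1, Nat.sub_one_lt_of_lt hh⟩ : Fin h))]
  · congr 1
    · have hterm : ∀ s' ∈ Finset.univ.erase (⟨h - 1, Nat.sub_one_lt_of_lt hh⟩ : Fin h), ∀ J ∈ B,
          A.der (.u s I) (A.timeDerivCoord F (s', J)) * A.du (s', J) f =
            if (s : ℕ) = s' + 1 then if I = J then A.du (s', J) f else 0 else 0 := by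
        intro s' hs' J _
        have hne : (s' : ℕ) + 1 < h := by
          have h1 := (Finset.mem_erase.1 hs').1
          have h2 : (s' : ℕ) ≠ h - 1 := fun h2 => h1 (Fin.ext h2)
          omega
        simp only [timeDerivCoord, hne, dif_pos, A.der_X, JetVar.u.injEq, Fin.ext_iff]
        by_cases h1 : (s : ℕ) = s' + 1 <;> by_cases h2 : I = J <;> simp [h1, h2]
      rw [Finset.sum_congr rfl fun s' hs' => Finset.sum_congr rfl (hterm s' hs')]
      split_ifs with hs
      · rw [Finset.sum_eq_single_of_mem ⟨s - 1, lt_of_le_of_lt (Nat.sub_le _ _) s.2⟩]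
        · have : (s : ℕ) = s - 1 + 1 := by omega
          simp only [← this, if_true, Finset.sum_ite_eq]
          split_ifs with hIB
          · rfl
          · exact (hB I hIB _).symm
        · refine Finset.mem_erase.2 ⟨fun heq => ?_, Finset.mem_univ _⟩
          have := congrArg Fin.val heq
          have := s.2
          simp only at *
          omega
        · intro s' _ hne
          refine Finset.sum_eq_zero fun J _ => if_neg fun heq => hne (Fin.ext ?_)
          simp only
          omega
      · refine Finset.sum_eq_zero fun s' _ => Finset.sum_eq_zero fun J _ => if_neg ?_
        omega
    · refine Finset.sum_congr rfl fun J _ => ?_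
      have : ¬ (h - 1 + 1 < h) := by omega
      simp [timeDerivCoord, this, du]
  · intro J hJ
    by_contra hJB
    exact hJ (by simp [hB J hJB])
  · rintro ⟨s', J⟩ hJ
    by_contra hJB
    exact hJ (by simp [hB J (by simpa using hJB)])

/-- The adjoint of the operator `∑_I (∂f/∂u_{s,I}) D_x^I`. -/
def adj (s : Fin h) (f : R) : Module.End ℝ R :=
  ∑ᶠ I, (-1 : ℝ) ^ len I • (A.DxPow I * LinearMap.mulLeft ℝ (A.du (s, I) f))

theorem adj_eq_sum {s : Fin h} {f : R} {B : Finset (Fin n → ℕ)}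
    (hB : ∀ I ∉ B, A.du (s, I) f = 0) (g : R) :
    A.adj s f g = ∑ I ∈ B, (-1 : ℝ) ^ len I • A.DxPow I (A.du (s, I) f * g) := by
  rw [adj, finsum_eq_sum_of_support_subset (s := B), LinearMap.sum_apply]
  · rfl
  · intro I hI
    by_contra hIB
    exact hI (by simp [hB I hIB])

theorem finite_support_of_du {M : Type*} [Zero M] {s : Fin h} {f : R} {φ : (Fin n → ℕ) → M}
    (hφ : ∀ I, A.du (s, I) f = 0 → φ I = 0) : (Function.support φ).Finite := by
  obtain ⟨B, hB⟩ := A.exists_multiIndex_support f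
  refine B.finite_toSet.subset fun I hI => ?_
  by_contra hIB
  exact hI (hφ I (hB I hIB s))

theorem adj_apply (s : Fin h) (f g : R) :
    A.adj s f g = ∑ᶠ I, (-1 : ℝ) ^ len I • A.DxPow I (A.du (s, I) f * g) := by
  obtain ⟨B, hB⟩ := A.exists_multiIndex_support f
  rw [A.adj_eq_sum (fun I hI => hB I hI s), finsum_eq_sum_of_support_subset]
  intro I hI
  by_contra hIB
  exact hI (by simp [hB I hIB])

theorem adj_add (s : Fin h) (f f' g : R) : A.adj s (f + f') g = A.adj s f g + A.adj s f' g := by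
  simp only [adj_apply, map_add, add_mul, smul_add]
  exact finsum_add_distrib (A.finite_support_of_du (s := s) (f := f) fun I hI => by simp [hI])
    (A.finite_support_of_du (s := s) (f := f') fun I hI => by simp [hI])

theorem adj_zero (s : Fin h) (g : R) : A.adj s 0 g = 0 := by
  simp [adj_apply]

theorem adj_sum {ι : Type*} (s : Fin h) (T : Finset ι) (f : ι → R) (g : R) :
    A.adj s (∑ i ∈ T, f i) g = ∑ i ∈ T, A.adj s (f i) g :=
  map_sum ({ toFun := fun f => A.adj s f g, map_zero' := A.adj_zero s g,
             map_add' := fun f f' => A.adj_add s f f' g } : R →+ R) f T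

/-- The linearization of `D_{x_i} f` is `D_{x_i}` composed with that of `f`, and the adjoint of
`D_{x_i}` is `-D_{x_i}`. With `g = 1` this says that the Euler-type operators `adj s · 1` kill
spatial divergences. -/
theorem adj_Dx (s : Fin h) (i : Fin n) (f g : R) :
    A.adj s (A.Dx i f) g = -A.adj s f (A.Dx i g) := by
  let ψ : (Fin n → ℕ) → R := fun I =>
    (-1 : ℝ) ^ len (I + Pi.single i 1) • A.DxPow (I + Pi.single i 1) (A.du (s, I) f * g)
  have hψ : (Function.support ψ).Finite :=
    A.finite_support_of_du (s := s) (f := f) fun I hI => by simp [ψ, hI]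
  have hψ' : (Function.support fun I : Fin n → ℕ =>
      if 1 ≤ I i then ψ (I - Pi.single i 1) else 0).Finite := by
    refine (hψ.image (· + Pi.single i 1)).subset fun I hI => ?_
    have hIi : 1 ≤ I i := by
      by_contra hIi
      simp [hIi] at hI
    refine ⟨I - Pi.single i 1, ?_, tsub_add_cancel_of_le (single_le_iff.2 hIi)⟩
    simpa [hIi] using hI
  have h1 : ∀ I : Fin n → ℕ, (-1 : ℝ) ^ len I • A.DxPow I (A.du (s, I) (A.Dx i f) * g) =
      (-1 : ℝ) ^ len I • A.DxPow I (A.Dx i (A.du (s, I) f) * g) +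
        if 1 ≤ I i then ψ (I - Pi.single i 1) else 0 := by
    intro I
    rw [du_Dx, add_mul, map_add, smul_add]
    congr 1
    split_ifs with hI
    · simp only [ψ, tsub_add_cancel_of_le (single_le_iff.2 hI)]
    · simp
  rw [adj_apply, finsum_congr h1, finsum_add_distrib
    (A.finite_support_of_du (s := s) (f := f) fun I hI => by simp [hI]) hψ',
    finsum_ite_sub_single, ← finsum_add_distrib
    (A.finite_support_of_du (s := s) (f := f) fun I hI => by simp [hI]) hψ, adj_apply,
    ← finsum_neg_distrib]
  refine finsum_congr fun I => ?_
  simp only [ψ, len_add, len_single, pow_succ, DxPow_add_single]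
  rw [Dx_DxPow, Derivation.leibniz, smul_eq_mul, smul_eq_mul, map_add,
    mul_comm g]
  simp

theorem adj_DxPow (s : Fin h) (J : Fin n → ℕ) (f g : R) :
    A.adj s (A.DxPow J f) g = (-1 : ℝ) ^ len J • A.adj s f (A.DxPow J g) := by
  induction J using multiIndex_induction generalizing g with
  | zero => simp [DxPow_zero, len_zero]
  | add_single J i ih =>
    rw [DxPow_add_single, adj_Dx, ih, DxPow_add_single, Dx_DxPow, len_add, len_single, pow_succ]
    simp

/-- The three terms match those of `du_Dt`. In the last one, `adj_DxPow` moves each `D_x^J` off `F`,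
so the sum over `J` reassembles into `adj (h - 1) f 1`. -/
theorem adj_Dt_one (hh : 0 < h) (F : R) (s : Fin h) (f : R) :
    A.adj s (A.Dt F f) 1 = A.Dt F (A.adj s f 1) +
      (if 1 ≤ (s : ℕ) then A.adj ⟨s - 1, lt_of_le_of_lt (Nat.sub_le _ _) s.2⟩ f 1 else 0) +
      A.adj s F (A.adj ⟨h - 1, Nat.sub_one_lt_of_lt hh⟩ f 1) := by
  classical
  obtain ⟨B₀, hB₀⟩ := A.exists_multiIndex_support f
  obtain ⟨B₁, hB₁⟩ := A.exists_multiIndex_support (A.Dt F f)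
  choose B₂ hB₂ using fun J => A.exists_multiIndex_support (A.DxPow J F)
  set l : Fin h := ⟨h - 1, Nat.sub_one_lt_of_lt hh⟩
  -- One finite index set supporting all the sums, so that they can be exchanged.
  set B := B₀ ∪ B₁ ∪ B₀.biUnion B₂ with hBdef
  have hBf : ∀ s, ∀ I ∉ B, A.du (s, I) f = 0 := fun s I hI => hB₀ I (by simp_all) s
  have hBD : ∀ I ∉ B, A.du (s, I) (A.Dt F f) = 0 := fun I hI => hB₁ I (by simp_all) s
  have hBF : ∀ J ∈ B₀, ∀ I ∉ B, A.du (s, I) (A.DxPow J F) = 0 := fun J hJ I hI =>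
    hB₂ J I (by simp only [hBdef, Finset.mem_union, Finset.mem_biUnion] at hI; grind) s
  have hlast : ∀ I, ∑ᶠ J, A.du (s, I) (A.DxPow J F) * A.du (l, J) f =
      ∑ J ∈ B₀, A.du (s, I) (A.DxPow J F) * A.du (l, J) f := by
    intro I
    rw [finsum_eq_sum_of_support_subset]
    intro J hJ
    by_contra hJB
    exact hJ (by simp [hB₀ J hJB])
  rw [A.adj_eq_sum hBD, A.adj_eq_sum (hBf s), A.adj_eq_sum (B := B₀) fun J hJ => hB₀ J hJ l]
  simp only [mul_one, A.du_Dt hh, map_add, smul_add, Finset.sum_add_distrib]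
  congr 1
  · congr 1
    · rw [map_sum]
      refine Finset.sum_congr rfl fun I _ => ?_
      rw [Derivation.map_smul, Dt_DxPow]
    · split_ifs with hs
      · rw [A.adj_eq_sum (hBf _)]
        simp
      · simp
  · rw [map_sum]
    change ∑ I ∈ B, (-1 : ℝ) ^ len I • A.DxPow I (∑ᶠ J, A.du (s, I) (A.DxPow J F) * A.du (l, J) f) = _
    simp only [hlast, map_sum, Finset.smul_sum]
    rw [Finset.sum_comm]
    refine Finset.sum_congr rfl fun J hJ => ?_
    rw [map_smul, ← adj_DxPow, A.adj_eq_sum (hBF J hJ)]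

/-- The iterated total time derivative. -/
def DtPow (F : R) (j : ℕ) : Module.End ℝ R := (A.Dt F : Module.End ℝ R) ^ j

theorem DtPow_zero (F f : R) : A.DtPow F 0 f = f := by simp [DtPow]

theorem DtPow_succ (F f : R) (j : ℕ) : A.DtPow F (j + 1) f = A.Dt F (A.DtPow F j f) := by
  rw [DtPow, pow_succ']
  rfl

/-- Applying `adj s · 1` to the conservation identity removes the spatial divergence and leaves, by
`adj_Dt_one`, a recurrence in `s` for the elements `adj s J₀ 1`. The last of these is the
characteristic, and `telescope_adjoint` eliminates the others. -/
theorem adjoint_equation (hh : 0 < h) (F : R) (J₀ : R) (J : Fin n → R)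
    (hJ : A.Dt F J₀ + ∑ i, A.Dx i (J i) = 0) :
    (-1 : ℝ) ^ h • A.DtPow F h (A.adj ⟨h - 1, Nat.sub_one_lt_of_lt hh⟩ J₀ 1) =
      ∑ s : Fin h, (-1 : ℝ) ^ (s : ℕ) •
        A.DtPow F s (A.adj s F (A.adj ⟨h - 1, Nat.sub_one_lt_of_lt hh⟩ J₀ 1)) := by
  refine telescope_adjoint hh (A.Dt F : Module.End ℝ R) (fun s => A.adj s J₀ 1) _ fun s => ?_
  have h0 : A.adj s (A.Dt F J₀ + ∑ i, A.Dx i (J i)) 1 = 0 := by rw [hJ, adj_zero]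
  rw [adj_add, adj_sum] at h0
  simp only [adj_Dx, Derivation.map_one_eq_zero, map_zero, neg_zero, Finset.sum_const_zero,
    add_zero] at h0
  rw [A.adj_Dt_one hh] at h0
  exact h0

/-- The adjoint linearization, with the derivations moved to the right by the Leibniz rule. -/
theorem adj_eq_sum_DxPow {s : Fin h} {f : R} {B : Finset (Fin n → ℕ)}
    (hB : ∀ I ∉ B, A.du (s, I) f = 0) {T : Finset (Fin n → ℕ)} (hT : ∀ I ∈ B, Finset.Iic I ⊆ T)
    (g : R) :
    A.adj s f g = ∑ K ∈ T, (∑ I ∈ B, ((-1 : ℝ) ^ len I * ((∏ i, (I i).choose (K i) : ℕ) : ℝ)) •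
      A.DxPow (I - K) (A.du (s, I) f)) * A.DxPow K g := by
  rw [A.adj_eq_sum hB]
  simp only [Finset.sum_mul]
  rw [Finset.sum_comm]
  refine Finset.sum_congr rfl fun I hI => ?_
  rw [DxPow, multiPow_derivation_mul A.commute_Dx, Finset.smul_sum]
  rw [Finset.sum_subset (hT I hI)]
  · refine Finset.sum_congr rfl fun K _ => ?_
    rw [smul_smul, smul_mul_assoc]
    rfl
  · intro K _ hK
    rw [prod_choose_eq_zero (by simpa using hK)]
    simp

end JetAlgebra

/-! ### Leading dependence of iterated derivatives and comparison of symbols -/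

namespace JetAlgebra

variable {R : Type*} [CommRing R] [Algebra ℝ R] (A : JetAlgebra n h R)

theorem du_DxPow_of_lt {s : Fin h} {f : R} {m : ℕ} (hf : ∀ I, m < len I → A.du (s, I) f = 0)
    (J I : Fin n → ℕ) (hIJ : m + len J < len I) : A.du (s, I) (A.DxPow J f) = 0 := by
  induction J using multiIndex_induction generalizing I with
  | zero => simpa [DxPow_zero] using hf I (by simpa [len_zero] using hIJ)
  | add_single J i ih =>
    rw [len_add, len_single] at hIJ
    rw [DxPow_add_single, du_Dx, ih I (by omega), map_zero, zero_add]
    split_ifs with hI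
    · refine ih _ ?_
      have := len_add (I - Pi.single i 1) (Pi.single i 1)
      rw [tsub_add_cancel_of_le (single_le_iff.2 hI), len_single] at this
      omega
    · rfl

open scoped Classical in
theorem du_DxPow_top {s : Fin h} {f : R} {m : ℕ} (hf : ∀ I, m < len I → A.du (s, I) f = 0)
    (J I : Fin n → ℕ) (hIJ : len I = m + len J) :
    A.du (s, I) (A.DxPow J f) = if J ≤ I then A.du (s, I - J) f else 0 := by
  induction J using multiIndex_induction generalizing I with
  | zero => simp [DxPow_zero]
  | add_single J i ih =>
    rw [len_add, len_single] at hIJ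
    rw [DxPow_add_single, du_Dx, A.du_DxPow_of_lt hf _ _ (by omega), map_zero, zero_add]
    by_cases hI : 1 ≤ I i
    · have hs := single_le_iff.2 hI
      have := len_add (I - Pi.single i 1) (Pi.single i 1)
      rw [tsub_add_cancel_of_le hs, len_single] at this
      rw [if_pos hI, ih _ (by omega), tsub_tsub, add_comm (Pi.single i 1)]
      simp only [le_tsub_iff_right hs]
    · rw [if_neg hI, if_neg]
      exact fun hle => hI (single_le_iff.1 (le_trans le_add_self hle))

variable {F : R} {N : ℕ}

/-- A bound on the derivatives `u_{s,I}` on which the `j`-th time derivative of a function can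
depend, if the function itself depends on the `u_{s,I}` with `|I| < k` and the `u_{s,I}` with
`|I| = k`, `s ≤ c` only. -/
def DtBound (N k c j : ℕ) (f : R) : Prop :=
  ∀ (s : Fin h) (I : Fin n → ℕ), A.du (s, I) f ≠ 0 →
    (len I ≤ k ∧ (len I = k → (s : ℕ) ≤ c + j)) ∨
      (len I ≤ k + N ∧ (s : ℕ) + 1 ≤ j ∧ (len I = k + N → (s : ℕ) + h ≤ c + j))

section

variable (hF₀ : ∀ (s : Fin h) (I : Fin n → ℕ), (s : ℕ) = 0 → N < len I → A.du (s, I) F = 0)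
  (hF₁ : ∀ (s : Fin h) (I : Fin n → ℕ), 1 ≤ (s : ℕ) → 0 < len I → A.du (s, I) F = 0)

include hF₀ hF₁

theorem len_le_of_du_DxPow_ne_zero {s : Fin h} {I J : Fin n → ℕ}
    (hne : A.du (s, I) (A.DxPow J F) ≠ 0) :
    ((s : ℕ) = 0 ∧ len I ≤ N + len J) ∨ (1 ≤ (s : ℕ) ∧ len I ≤ len J) := by
  rcases Nat.eq_zero_or_pos (s : ℕ) with hs | hs
  · refine Or.inl ⟨hs, ?_⟩
    by_contra hlt
    exact hne (A.du_DxPow_of_lt (fun I hI => hF₀ s I hs hI) J I (by omega))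
  · refine Or.inr ⟨hs, ?_⟩
    by_contra hlt
    exact hne (A.du_DxPow_of_lt (fun I hI => hF₁ s I hs hI) J I (by omega))

/-- Passing from level `h - 1` through `F` lands either on level `0` with at most `N` more space
derivatives, or on a positive level with none. The clause `s + 1 ≤ j` in `DtBound` keeps variables
of the second kind below level `h - 1` while `j < h`, so no second passage occurs. -/
theorem dtBound_Dt (hh : 0 < h) {k c j : ℕ} {f : R} (hf : A.DtBound N k c j f) (hj : j < h) :
    A.DtBound N k c (j + 1) (A.Dt F f) := by
  intro s I hne
  by_contra hcon
  refine hne ?_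
  rw [A.du_Dt hh]
  have h1 : A.du (s, I) f = 0 := by
    by_contra h1
    have := hf s I h1
    omega
  have h2 : (if 1 ≤ (s : ℕ) then
      A.du (⟨s - 1, lt_of_le_of_lt (Nat.sub_le _ _) s.2⟩, I) f else 0) = 0 := by
    split_ifs with hs
    · by_contra h2
      have := hf _ I h2
      simp only at this
      omega
    · rfl
  have h3 : ∀ J, A.du (s, I) (A.DxPow J F) *
      A.du (⟨h - 1, Nat.sub_one_lt_of_lt hh⟩, J) f = 0 := by
    intro J
    by_contra h3
    have h4 := A.len_le_of_du_DxPow_ne_zero hF₀ hF₁ (left_ne_zero_of_mul h3)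
    have h5 := hf _ J (right_ne_zero_of_mul h3)
    have := s.2
    simp only at h5
    omega
  rw [h1, h2, map_zero, finsum_congr h3, finsum_zero]
  simp

variable {χ : R} {k : ℕ} {c : Fin h}
  (hχ : ∀ (s : Fin h) (I : Fin n → ℕ), k < len I → A.du (s, I) χ = 0)
  (hc : ∀ (s : Fin h) (I : Fin n → ℕ), c < s → len I = k → A.du (s, I) χ = 0)

include hχ hc

theorem dtBound_DtPow {j : ℕ} (hj : j ≤ h) : A.DtBound N k c j (A.DtPow F j χ) := by
  induction j with
  | zero =>
    intro s I hne
    rw [DtPow_zero] at hne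
    refine Or.inl ⟨?_, fun hI => ?_⟩
    · by_contra hI
      exact hne (hχ s I (by omega))
    · by_contra hs
      exact hne (hc s I (by simpa using hs) hI)
  | succ j ih =>
    rw [DtPow_succ]
    exact A.dtBound_Dt hF₀ hF₁ (lt_of_lt_of_le (Nat.succ_pos j) hj) (ih (by omega)) hj

theorem du_DtPow_eq_zero (hN : 0 < N) {j : ℕ} (hj : j < h) {I : Fin n → ℕ} (hI : len I = k + N) :
    A.du (c, I) (A.DtPow F j χ) = 0 := by
  by_contra hne
  have := A.dtBound_DtPow hF₀ hF₁ hχ hc hj.le c I hne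
  omega

/-- Before level `h - 1` is passed, `D_t` only shifts the leading variables up. By maximality of
`c`, nothing else contributes at length `k`. -/
theorem du_DtPow_low {J : Fin n → ℕ} (hJ : len J = k) (i : ℕ) (hi : c + i < h) :
    A.du (⟨c + i, hi⟩, J) (A.DtPow F i χ) = A.du (c, J) χ := by
  induction i with
  | zero => simp [DtPow_zero]
  | succ i ih =>
    have hh : 0 < h := by omega
    have hb := A.dtBound_DtPow hF₀ hF₁ hχ hc (show i ≤ h by omega)
    rw [DtPow_succ, A.du_Dt hh]
    have h1 : A.du (⟨c + (i + 1), hi⟩, J) (A.DtPow F i χ) = 0 := by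
      by_contra h1
      have := hb _ J h1
      simp only at this
      omega
    have h3 : ∀ J', A.du (⟨c + (i + 1), hi⟩, J) (A.DxPow J' F) *
        A.du (⟨h - 1, Nat.sub_one_lt_of_lt hh⟩, J') (A.DtPow F i χ) = 0 := by
      intro J'
      by_contra h3
      have h4 := A.len_le_of_du_DxPow_ne_zero hF₀ hF₁ (left_ne_zero_of_mul h3)
      have h5 := hb _ J' (right_ne_zero_of_mul h3)
      simp only at h4 h5
      omega
    rw [h1, map_zero, finsum_congr h3, finsum_zero, zero_add, add_zero,
      if_pos (by simp only; omega), ← ih (by omega)]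
    rfl

/-- This is the step at which `u_{h-1,J}` is replaced by `D_x^J F`. By `du_DxPow_top` its leading
part has the coefficients of `F` shifted by `J`, which produces the convolution of the two symbols.
-/
theorem du_DtPow_wrap (hN : 0 < N) (hh : 0 < h) {I : Fin n → ℕ} (hI : len I = k + N) :
    A.du (⟨0, hh⟩, I) (A.DtPow F (h - c) χ) = ∑ K ∈ Finset.Iic I,
      if len K = N then A.du (⟨0, hh⟩, K) F * A.du (c, I - K) χ else 0 := by
  classical
  have hb := A.dtBound_DtPow hF₀ hF₁ hχ hc (show h - 1 - c ≤ h by omega)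
  have hc' := c.2
  have hj : h - c = h - 1 - c + 1 := by omega
  rw [hj, DtPow_succ, A.du_Dt hh]
  have h1 : A.du (⟨0, hh⟩, I) (A.DtPow F (h - 1 - c) χ) = 0 := by
    by_contra h1
    have := hb _ I h1
    simp only at this
    omega
  have hlen : ∀ J ≤ I, len (I - J) + len J = k + N := by
    intro J hJ
    rw [← len_add, tsub_add_cancel_of_le hJ, hI]
  have h3 : ∀ J, A.du (⟨0, hh⟩, I) (A.DxPow J F) *
      A.du (⟨h - 1, Nat.sub_one_lt_of_lt hh⟩, J) (A.DtPow F (h - 1 - c) χ) =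
        if J ≤ I ∧ len J = k then A.du (⟨0, hh⟩, I - J) F * A.du (c, J) χ else 0 := by
    intro J
    by_cases hJ : len J = k
    · have e1 := A.du_DtPow_low hF₀ hF₁ hχ hc hJ (h - 1 - c) (by omega)
      have e2 : (⟨c + (h - 1 - c), by omega⟩ : Fin h) = ⟨h - 1, Nat.sub_one_lt_of_lt hh⟩ :=
        Fin.ext (by simp only; omega)
      rw [← e2, e1, A.du_DxPow_top (fun I hI => hF₀ _ I rfl hI) J I (by omega)]
      simp [hJ]
    · rw [if_neg (fun h => hJ h.2)]
      by_contra h3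
      have h4 := A.len_le_of_du_DxPow_ne_zero hF₀ hF₁ (left_ne_zero_of_mul h3)
      have h5 := hb _ J (right_ne_zero_of_mul h3)
      simp only at h4 h5
      omega
  rw [h1, map_zero, finsum_congr h3, if_neg (by simp), zero_add, zero_add,
    finsum_eq_sum_of_support_subset (s := Finset.Iic I)]
  · refine Finset.sum_nbij' (I - ·) (I - ·) (by simp) (by simp)
      (fun J hJ => tsub_tsub_cancel_of_le (Finset.mem_Iic.1 hJ))
      (fun J hJ => tsub_tsub_cancel_of_le (Finset.mem_Iic.1 hJ)) fun J hJ => ?_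
    have hJ' := Finset.mem_Iic.1 hJ
    have := hlen J hJ'
    have hiff : len J = k ↔ len (I - J) = N := by omega
    simp only [hJ', true_and, hiff, tsub_tsub_cancel_of_le]
  · intro J hJ
    by_contra hJI
    exact hJ (if_neg fun h => hJI (by simpa using h.1))

/-- After the passage through `F`, the remaining `c` time derivatives carry the coefficient
unchanged from level `0` to level `c`. -/
theorem du_DtPow_top (hN : 0 < N) (hh : 0 < h) {I : Fin n → ℕ} (hI : len I = k + N) :
    A.du (c, I) (A.DtPow F h χ) = ∑ K ∈ Finset.Iic I,
      if len K = N then A.du (⟨0, hh⟩, K) F * A.du (c, I - K) χ else 0 := by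
  suffices ∀ (i : ℕ) (hi : i ≤ (c : ℕ)), A.du (⟨i, lt_of_le_of_lt hi c.2⟩, I) (A.DtPow F (h - (c : ℕ) + i) χ) =
      ∑ K ∈ Finset.Iic I, if len K = N then A.du (⟨0, hh⟩, K) F * A.du (c, I - K) χ else 0 by
    have h1 := this c le_rfl
    rwa [Nat.sub_add_cancel c.2.le] at h1
  intro i
  have hc' := c.2
  induction i with
  | zero => exact fun _ => A.du_DtPow_wrap hF₀ hF₁ hχ hc hN hh hI
  | succ i ih =>
    intro hi
    have hb := A.dtBound_DtPow hF₀ hF₁ hχ hc (show h - c + i ≤ h by omega)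
    rw [← add_assoc, DtPow_succ, A.du_Dt hh, ← ih (by omega)]
    have h1 : A.du (⟨i + 1, lt_of_le_of_lt hi c.2⟩, I) (A.DtPow F (h - c + i) χ) = 0 := by
      by_contra h1
      have := hb _ I h1
      simp only at this
      omega
    have h3 : ∀ J, A.du (⟨i + 1, lt_of_le_of_lt hi c.2⟩, I) (A.DxPow J F) *
        A.du (⟨h - 1, Nat.sub_one_lt_of_lt hh⟩, J) (A.DtPow F (h - c + i) χ) = 0 := by
      intro J
      by_contra h3
      have h4 := A.len_le_of_du_DxPow_ne_zero hF₀ hF₁ (left_ne_zero_of_mul h3)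
      have h5 := hb _ J (right_ne_zero_of_mul h3)
      simp only at h4 h5
      omega
    rw [h1, map_zero, finsum_congr h3, finsum_zero, zero_add, add_zero, if_pos (by simp)]
    rfl

/-- A solution of the adjoint equation of high order has a symbol annihilated by the symbol of the
right-hand side. -/
theorem symbol_mul_eq_zero (hN : 0 < N) (hh : 0 < h) (hodd : Odd (N + h))
    {T : Finset (Fin n → ℕ)} {f : (Fin n → ℕ) → R} {g : ℕ → R}
    (heq : (-1 : ℝ) ^ h • A.DtPow F h χ =
      ∑ K ∈ T, f K * A.DxPow K χ + ∑ j ∈ Finset.Ico 1 h, g j * A.DtPow F j χ)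
    (hTN : ∀ K ∈ T, len K ≤ N)
    (hT : ∀ K ∉ T, len K = N → A.du (⟨0, hh⟩, K) F = 0)
    (hfN : ∀ K, len K = N → f K = (-1 : ℝ) ^ N • A.du (⟨0, hh⟩, K) F)
    (hf : ∀ K ∈ T, ∀ s I, len I = k + N → A.du (s, I) (f K) = 0)
    (hg : ∀ j ∈ Finset.Ico 1 h, ∀ s I, len I = k + N → A.du (s, I) (g j) = 0)
    {I : Fin n → ℕ} (hI : len I = k + N) :
    ∑ K ∈ Finset.Iic I,
      (if len K = N then A.du (⟨0, hh⟩, K) F * A.du (c, I - K) χ else 0) = 0 := by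
  classical
  set S := ∑ K ∈ Finset.Iic I,
      (if len K = N then A.du (⟨0, hh⟩, K) F * A.du (c, I - K) χ else 0) with hS
  have h0 := congrArg (A.du (c, I)) heq
  rw [Derivation.map_smul, A.du_DtPow_top hF₀ hF₁ hχ hc hN hh hI, map_add, map_sum, map_sum,
    ← hS] at h0
  have hgsum : ∑ j ∈ Finset.Ico 1 h, A.du (c, I) (g j * A.DtPow F j χ) = 0 := by
    refine Finset.sum_eq_zero fun j hj => ?_
    rw [Derivation.leibniz, hg j hj c I hI,
      A.du_DtPow_eq_zero hF₀ hF₁ hχ hc hN (Finset.mem_Ico.1 hj).2 hI]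
    simp
  have hfsum : ∑ K ∈ T, A.du (c, I) (f K * A.DxPow K χ) = (-1 : ℝ) ^ N • S := by
    have hterm : ∀ K ∈ T, A.du (c, I) (f K * A.DxPow K χ) =
        if K ≤ I then (-1 : ℝ) ^ N •
          (if len K = N then A.du (⟨0, hh⟩, K) F * A.du (c, I - K) χ else 0) else 0 := by
      intro K hK
      rw [Derivation.leibniz, hf K hK c I hI, smul_zero, add_zero, smul_eq_mul]
      by_cases hKN : len K = N
      · rw [A.du_DxPow_top (fun I hI => hχ c I hI) K I (by omega), hfN K hKN]
        simp [hKN]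
      · have := hTN K hK
        rw [A.du_DxPow_of_lt (fun I hI => hχ c I hI) K I (by omega)]
        simp [hKN]
    rw [Finset.sum_congr rfl hterm, ← Finset.sum_filter, hS, Finset.smul_sum]
    refine Finset.sum_subset (fun K hK => by simpa using (Finset.mem_filter.1 hK).2) ?_
    -- Indices outside `T` add nothing to `S`, since there the top coefficient of `F` vanishes.
    intro K hK hKT
    have : K ∉ T := fun hKT' => hKT (by simpa [hKT'] using hK)
    split_ifs with hKN
    · simp [hT K this hKN]
    · simp
  -- The comparison reads `((-1)^h - (-1)^N) • S = 0`, and the scalar is `±2` because `N` and `h`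
  -- have opposite parity.
  rw [hgsum, hfsum, add_zero, ← sub_eq_zero, ← sub_smul] at h0
  refine (smul_eq_zero_iff_right ?_).1 h0
  rcases Nat.even_or_odd h with he | ho
  · have hNo : Odd N := by
      rcases Nat.even_or_odd N with hNe | hNo
      · exact absurd (hNe.add he) (Nat.not_even_iff_odd.2 hodd)
      · exact hNo
    rw [he.neg_one_pow, hNo.neg_one_pow]
    norm_num
  · have hNe : Even N := by
      rcases Nat.even_or_odd N with hNe | hNo
      · exact hNe
      · exact absurd (hNo.add_odd ho) (Nat.not_even_iff_odd.2 hodd)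
    rw [ho.neg_one_pow, hNe.neg_one_pow]
    norm_num

end

end JetAlgebra

/-! ### Products of homogeneous polynomials; finiteness of multi-indices of bounded length -/

/-- The product of two nonzero homogeneous polynomials is nonzero. -/
theorem exists_homogeneous_mul_ne_zero {a b : (Fin n → ℕ) → ℝ} {N k : ℕ}
    (ha : ∃ K, len K = N ∧ a K ≠ 0) (hb : ∃ J, len J = k ∧ b J ≠ 0) :
    ∃ I, len I = k + N ∧
      ∑ K ∈ Finset.Iic I, (if len K = N then a K * b (I - K) else 0) ≠ 0 := by
  classical
  have hpoly : ∀ (a : (Fin n → ℕ) → ℝ) (N : ℕ), ∃ P : MvPolynomial (Fin n) ℝ,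
      ∀ m, P.coeff m = if len m = N then a m else 0 := by
    intro a N
    refine ⟨∑ K ∈ (Finset.Iic fun _ => N).filter fun K => len K = N,
      MvPolynomial.monomial (Finsupp.equivFunOnFinite.symm K) (a K), fun m => ?_⟩
    rw [MvPolynomial.coeff_sum]
    simp only [MvPolynomial.coeff_monomial]
    split_ifs with hm
    · rw [Finset.sum_eq_single_of_mem (m : Fin n → ℕ)]
      · simp
      · refine Finset.mem_filter.2 ⟨Finset.mem_Iic.2 fun i => ?_, hm⟩
        rw [← hm]
        exact Finset.single_le_sum (f := fun i => m i) (fun _ _ => Nat.zero_le _)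
          (Finset.mem_univ i)
      · intro K _ hK
        rw [if_neg]
        rintro rfl
        exact hK (by simp)
    · refine Finset.sum_eq_zero fun K hK => if_neg ?_
      rintro rfl
      exact hm (by simpa using (Finset.mem_filter.1 hK).2)
  obtain ⟨P, hP⟩ := hpoly a N
  obtain ⟨Q, hQ⟩ := hpoly b k
  obtain ⟨K, hK, haK⟩ := ha
  obtain ⟨J, hJ, hbJ⟩ := hb
  have hP0 : P ≠ 0 := by
    rintro rfl
    exact haK (by simpa [hK] using (hP (Finsupp.equivFunOnFinite.symm K)).symm)
  have hQ0 : Q ≠ 0 := by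
    rintro rfl
    exact hbJ (by simpa [hJ] using (hQ (Finsupp.equivFunOnFinite.symm J)).symm)
  -- Any nonzero coefficient of the product will do: homogeneity of the factors forces its exponent
  -- to have length `k + N`.
  obtain ⟨m, hm⟩ := MvPolynomial.ne_zero_iff.1 (mul_ne_zero hP0 hQ0)
  rw [MvPolynomial.coeff_mul] at hm
  simp only [hP, hQ] at hm
  obtain ⟨x, hx, hx0⟩ := Finset.exists_ne_zero_of_sum_ne_zero hm
  have hxN : len x.1 = N := by
    by_contra hxN
    simp [hxN] at hx0
  have hxk : len x.2 = k := by
    by_contra hxk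
    simp [hxk] at hx0
  have hmlen : len m = k + N := by
    rw [← Finset.HasAntidiagonal.mem_antidiagonal.1 hx, Finsupp.coe_add, len_add, hxN, hxk, add_comm]
  refine ⟨m, hmlen, ?_⟩
  convert hm using 1
  symm
  refine Finset.sum_bij' (fun x _ => (x.1 : Fin n → ℕ))
    (fun K _ => (Finsupp.equivFunOnFinite.symm K, m - Finsupp.equivFunOnFinite.symm K))
    ?_ ?_ ?_ ?_ ?_
  · intro x hx
    rw [← Finset.HasAntidiagonal.mem_antidiagonal.1 hx]
    simp
  · intro K hK
    rw [Finset.HasAntidiagonal.mem_antidiagonal]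
    exact add_tsub_cancel_of_le fun i => Finset.mem_Iic.1 hK i
  · intro x hx
    rw [← Finset.HasAntidiagonal.mem_antidiagonal.1 hx]
    ext <;> simp
  · intro K _
    simp
  · intro x hx
    have hxm := Finset.HasAntidiagonal.mem_antidiagonal.1 hx
    have h1 : (m : Fin n → ℕ) - x.1 = x.2 := by
      rw [← hxm]
      funext i
      simp
    have h2 : len x.1 + len x.2 = k + N := by
      rw [← hmlen, ← hxm, Finsupp.coe_add, len_add]
    rw [h1]
    by_cases hxN : len x.1 = N
    · have : len x.2 = k := by omega
      simp [hxN, this]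
    · simp [hxN]

theorem len_mono {I J : Fin n → ℕ} (hIJ : I ≤ J) : len I ≤ len J :=
  Finset.sum_le_sum fun i _ => hIJ i

theorem eq_of_le_of_len_le {I J : Fin n → ℕ} (hIJ : I ≤ J) (hlen : len J ≤ len I) : I = J := by
  funext i
  exact (Finset.sum_eq_sum_iff_of_le fun i _ => hIJ i).1 (le_antisymm (len_mono hIJ) hlen) i
    (Finset.mem_univ i)

theorem finite_setOf_len_le (N : ℕ) : {K : Fin n → ℕ | len K ≤ N}.Finite :=
  (Set.finite_Iic fun _ => N).subset fun K hK i =>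
    (Finset.single_le_sum (f := K) (fun _ _ => Nat.zero_le _) (Finset.mem_univ i)).trans hK

/-! ### Normal form of the adjoint linearization -/

namespace JetAlgebra

variable {R : Type*} [CommRing R] [Algebra ℝ R] (A : JetAlgebra n h R)

/-- The coefficient of `D_t^j` in the adjoint linearization of `F`. -/
def timeCoeff (F : R) (j : ℕ) : R :=
  ∑ r ∈ Finset.univ.filter (fun r : Fin h => 1 ≤ (r : ℕ)),
    ((-1 : ℝ) ^ (r : ℕ) * ((r : ℕ).choose j : ℝ)) • A.DtPow F ((r : ℕ) - j) (A.du (r, 0) F)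

/-- The coefficient of `D_x^K` in the adjoint linearization of `F`. -/
def spaceCoeff (hh : 0 < h) (F : R) (K : Fin n → ℕ) : R :=
  (∑ᶠ I : Fin n → ℕ, ((-1 : ℝ) ^ len I * ((∏ i, (I i).choose (K i) : ℕ) : ℝ)) •
    A.DxPow (I - K) (A.du (⟨0, hh⟩, I) F)) + if K = 0 then A.timeCoeff F 0 else 0

theorem finsum_spaceCoeff_eq_sum (hh : 0 < h) {F : R} {B : Finset (Fin n → ℕ)}
    (hB : ∀ I ∉ B, A.du (⟨0, hh⟩, I) F = 0) (K : Fin n → ℕ) :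
    ∑ᶠ I : Fin n → ℕ, ((-1 : ℝ) ^ len I * ((∏ i, (I i).choose (K i) : ℕ) : ℝ)) •
      A.DxPow (I - K) (A.du (⟨0, hh⟩, I) F) =
    ∑ I ∈ B, ((-1 : ℝ) ^ len I * ((∏ i, (I i).choose (K i) : ℕ) : ℝ)) •
      A.DxPow (I - K) (A.du (⟨0, hh⟩, I) F) := by
  refine finsum_eq_sum_of_support_subset _ fun I hI => ?_
  by_contra hIB
  exact hI (by simp [hB I hIB])

theorem sum_DtPow_mul (F g : R) :
    ∑ r ∈ Finset.univ.filter (fun r : Fin h => 1 ≤ (r : ℕ)),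
      (-1 : ℝ) ^ (r : ℕ) • A.DtPow F r (A.du (r, 0) F * g) =
    ∑ j ∈ Finset.range h, A.timeCoeff F j * A.DtPow F j g := by
  simp only [timeCoeff, Finset.sum_mul]
  rw [Finset.sum_comm]
  refine Finset.sum_congr rfl fun r _ => ?_
  rw [DtPow, derivation_pow_mul, Finset.smul_sum]
  have hsub : Finset.range ((r : ℕ) + 1) ⊆ Finset.range h := Finset.range_subset_range.2 r.2
  rw [Finset.sum_subset hsub]
  · refine Finset.sum_congr rfl fun j _ => ?_
    rw [smul_smul, smul_mul_assoc]
    rfl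
  · intro j _ hj
    rw [Nat.choose_eq_zero_of_lt (by simpa using hj)]
    simp

/-- For `s ≥ 1`, `F` involves only `u_{s,0}`, so the adjoint is multiplication by `∂F/∂u_{s,0}`; the
Leibniz rules do the rest. The `D_t^0` term is moved into the coefficient of `D_x^0`, hence `0 ∈ T`.
-/
theorem adjoint_normal_form (hh : 0 < h) {F χ : R}
    (hF₁ : ∀ (s : Fin h) (I : Fin n → ℕ), 1 ≤ (s : ℕ) → 0 < len I → A.du (s, I) F = 0)
    (hχ : (-1 : ℝ) ^ h • A.DtPow F h χ =
      ∑ s : Fin h, (-1 : ℝ) ^ (s : ℕ) • A.DtPow F s (A.adj s F χ))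
    {B T : Finset (Fin n → ℕ)} (hB : ∀ I ∉ B, A.du (⟨0, hh⟩, I) F = 0)
    (hT : ∀ I ∈ B, Finset.Iic I ⊆ T) (hT0 : 0 ∈ T) :
    (-1 : ℝ) ^ h • A.DtPow F h χ = ∑ K ∈ T, A.spaceCoeff hh F K * A.DxPow K χ +
      ∑ j ∈ Finset.Ico 1 h, A.timeCoeff F j * A.DtPow F j χ := by
  have hzero : ∑ s ∈ Finset.univ.filter (fun s : Fin h => ¬ 1 ≤ (s : ℕ)),
      (-1 : ℝ) ^ (s : ℕ) • A.DtPow F s (A.adj s F χ) = A.adj ⟨0, hh⟩ F χ := by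
    have : Finset.univ.filter (fun s : Fin h => ¬ 1 ≤ (s : ℕ)) = {⟨0, hh⟩} := by
      ext s
      simp [Fin.ext_iff]
    rw [this, Finset.sum_singleton, DtPow_zero]
    simp
  have hpos : ∀ s ∈ Finset.univ.filter (fun s : Fin h => 1 ≤ (s : ℕ)),
      (-1 : ℝ) ^ (s : ℕ) • A.DtPow F s (A.adj s F χ) =
        (-1 : ℝ) ^ (s : ℕ) • A.DtPow F s (A.du (s, 0) F * χ) := by
    intro s hs
    rw [A.adj_eq_sum (B := {0}), Finset.sum_singleton, DxPow_zero, len_zero, pow_zero, one_smul]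
    intro I hI
    refine hF₁ s I (Finset.mem_filter.1 hs).2 (Nat.pos_of_ne_zero fun h0 => hI ?_)
    rw [Finset.mem_singleton]
    exact (eq_of_le_of_len_le (zero_le (a := I)) (by rw [h0]; exact Nat.zero_le _)).symm
  rw [hχ, ← Finset.sum_filter_add_sum_filter_not _ (fun s : Fin h => 1 ≤ (s : ℕ)), hzero,
    Finset.sum_congr rfl hpos, sum_DtPow_mul, A.adj_eq_sum_DxPow hB hT, Finset.range_eq_Ico,
    Finset.sum_eq_sum_Ico_succ_bot hh]
  simp only [spaceCoeff, A.finsum_spaceCoeff_eq_sum hh hB, add_mul, Finset.sum_add_distrib,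
    ite_mul, zero_mul, Finset.sum_ite_eq', hT0, if_true, DtPow_zero, DxPow_zero]
  abel

/-- A term indexed by `I` contributes to `D_x^K` only if `K ≤ I`. With `|I| ≤ N = |K|` this leaves
`I = K`, where no derivative falls on the coefficient. -/
theorem spaceCoeff_top (hh : 0 < h) {F : R} {N : ℕ} (hN : 0 < N)
    {B : Finset (Fin n → ℕ)} (hB : ∀ I ∉ B, A.du (⟨0, hh⟩, I) F = 0)
    (hBN : ∀ I ∈ B, len I ≤ N) {K : Fin n → ℕ} (hK : len K = N) :
    A.spaceCoeff hh F K = (-1 : ℝ) ^ N • A.du (⟨0, hh⟩, K) F := by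
  have hK0 : K ≠ 0 := by
    rintro rfl
    rw [len_zero] at hK
    omega
  rw [spaceCoeff, if_neg hK0, add_zero, A.finsum_spaceCoeff_eq_sum hh hB,
    Finset.sum_eq_single K]
  · simp [DxPow_zero, hK]
  · intro I hI hIK
    rw [prod_choose_eq_zero fun hle => hIK (eq_of_le_of_len_le hle (by
      rw [hK]; exact hBN I hI)).symm]
    simp
  · intro hKB
    simp [hB K hKB]

end JetAlgebra

/-! ### Transfer between concrete functions and the abstract jet algebra -/

section transfer

variable {U : Set (JetSpace n h)}

/-- The evaluation at a point of `U`. -/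
def ev (p : U) : smoothAlg U →ₐ[ℝ] ℝ := (Pi.evalAlgHom ℝ (fun _ : U => ℝ) p).comp (smoothAlg U).val

theorem smoothAlg_ext {r r' : smoothAlg U} (hr : ∀ p, ev p r = ev p r') : r = r' :=
  Subtype.ext (funext hr)

/-- The function `f` restricts to the element `r` of the algebra of smooth functions on `U`. -/
def Represents (f : JetSpace n h → ℝ) (r : smoothAlg U) : Prop := ∀ p : U, f p = ev p r

theorem ev_finsum {ι : Type*} {r : ι → smoothAlg U} (hr : (Function.support r).Finite) (p : U) :
    ev p (∑ᶠ i, r i) = ∑ᶠ i, ev p (r i) := map_finsum (ev p) hr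

theorem isOpen_ev_ne_zero (hU : IsOpen U) (r : smoothAlg U) :
    IsOpen {p | ∃ hp : p ∈ U, ev ⟨p, hp⟩ r ≠ 0} := by
  have : {p | ∃ hp : p ∈ U, ev ⟨p, hp⟩ r ≠ 0} = U ∩ extend r ⁻¹' {0}ᶜ := by
    ext p
    constructor
    · rintro ⟨hp, hne⟩
      refine ⟨hp, fun h0 => hne ?_⟩
      exact (extend_apply r ⟨p, hp⟩).trans h0
    · rintro ⟨hp, hne⟩
      exact ⟨hp, fun h0 => hne ((extend_apply r ⟨p, hp⟩).symm.trans h0)⟩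
  rw [this]
  exact (smoothOn_extend r).continuousOn.isOpen_inter_preimage hU isOpen_compl_singleton

variable (hU : IsOpen U) {f F : JetSpace n h → ℝ} {r rF : smoothAlg U}

include hU

theorem Represents.pd (hf : Represents f r) (v : JetVar n h) :
    Represents (pd v f) ((smoothJetAlgebra hU).der v r) :=
  fun p => smoothJetAlgebra_der_apply hU v hf p

theorem Represents.field (hf : Represents f r) (e : JetVar n h)
    {a : Fin h × (Fin n → ℕ) → JetSpace n h → ℝ} {b : Fin h × (Fin n → ℕ) → smoothAlg U}
    (hab : ∀ v, Represents (a v) (b v)) :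
    Represents (fun p => GenEvolution.pd e f p + ∑ᶠ v : Fin h × (Fin n → ℕ),
      a v p * GenEvolution.pd (.u v.1 v.2) f p) ((smoothJetAlgebra hU).field e b r) := by
  intro p
  rw [JetAlgebra.field_apply, map_add, ← hf.pd hU e p, ev_finsum]
  · refine congrArg (GenEvolution.pd e f p + ·) (finsum_congr fun v => ?_)
    rw [map_mul, ← hab v p, JetAlgebra.du, ← hf.pd hU]
  · exact ((smoothJetAlgebra hU).finite_du r).subset fun v hv => right_ne_zero_of_mul hv

theorem Represents.Dx (hf : Represents f r) (i : Fin n) :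
    Represents (Dx i f) ((smoothJetAlgebra hU).Dx i r) :=
  hf.field hU _ fun _ _ => rfl

theorem Represents.DxPow (hf : Represents f r) (I : Fin n → ℕ) :
    Represents (DxPow I f) ((smoothJetAlgebra hU).DxPow I r) := by
  rw [JetAlgebra.DxPow, multiPow_end_apply, GenEvolution.DxPow]
  induction List.finRange n with
  | nil => exact hf
  | cons i l ih =>
    rw [List.foldr_cons, List.foldr_cons]
    induction I i with
    | zero => exact ih
    | succ m ihm =>
      rw [Function.iterate_succ_apply', Function.iterate_succ_apply']
      exact ihm.Dx hU i

theorem Represents.Dt (hF : Represents F rF) (hf : Represents f r) :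
    Represents (Dt F f) ((smoothJetAlgebra hU).Dt rF r) := by
  refine hf.field hU _ fun v p => ?_
  by_cases hs : (v.1 : ℕ) + 1 < h
  · simp only [timeDerivCoord, JetAlgebra.timeDerivCoord, hs, dif_pos]
    rfl
  · simp only [timeDerivCoord, JetAlgebra.timeDerivCoord, hs, dif_neg, not_false_eq_true]
    exact hF.DxPow hU v.2 p

theorem Represents.DtPow (hF : Represents F rF) (hf : Represents f r) (j : ℕ) :
    Represents ((GenEvolution.Dt F)^[j] f) ((smoothJetAlgebra hU).DtPow rF j r) := by
  induction j with
  | zero => simpa [JetAlgebra.DtPow_zero] using hf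
  | succ j ih =>
    rw [Function.iterate_succ_apply', JetAlgebra.DtPow_succ]
    exact hF.Dt hU ih

theorem Represents.timeCoeff (hF : Represents F rF) (j : ℕ) :
    Represents (timeCoeff F j) ((smoothJetAlgebra hU).timeCoeff rF j) := by
  intro p
  simp only [GenEvolution.timeCoeff, JetAlgebra.timeCoeff, map_sum, map_smul, smul_eq_mul]
  refine Finset.sum_congr rfl fun s _ => ?_
  rw [hF.DtPow hU (hF.pd hU _) _ p]
  rfl

theorem Represents.spaceCoeff (hh : 0 < h) (hF : Represents F rF) (K : Fin n → ℕ) :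
    Represents (spaceCoeff hh F K) ((smoothJetAlgebra hU).spaceCoeff hh rF K) := by
  intro p
  rw [GenEvolution.spaceCoeff, JetAlgebra.spaceCoeff, map_add, ev_finsum]
  · congr 1
    · refine finsum_congr fun I => ?_
      rw [(hF.pd hU _).DxPow hU _ p, map_smul, smul_eq_mul]
      rfl
    · split_ifs
      · exact hF.timeCoeff hU 0 p
      · simp
  · exact (smoothJetAlgebra hU).finite_support_of_du (s := ⟨0, hh⟩) (f := rF)
      fun I hI => by simp [hI]

theorem represents_characteristic (hh : 0 < h) {J : Fin (n + 1) → JetSpace n h → ℝ}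
    (hf : Represents (J 0) r) : Represents (characteristic hh J)
      ((smoothJetAlgebra hU).adj ⟨h - 1, Nat.sub_one_lt_of_lt hh⟩ r 1) := by
  intro p
  rw [JetAlgebra.adj_apply, ev_finsum]
  · refine finsum_congr fun I => ?_
    rw [(hf.pd hU _).DxPow hU _ p, map_smul, smul_eq_mul, mul_one]
    rfl
  · exact (smoothJetAlgebra hU).finite_support_of_du (s := ⟨h - 1, Nat.sub_one_lt_of_lt hh⟩)
      (f := r) fun I hI => by simp [hI]

theorem Represents.du_ne_zero_iff (hf : Represents f r) (s : Fin h) (I : Fin n → ℕ) :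
    (smoothJetAlgebra hU).du (s, I) r ≠ 0 ↔ ∃ p ∈ U, GenEvolution.pd (.u s I) f p ≠ 0 := by
  constructor
  · intro hne
    by_contra! hcon
    exact hne (smoothAlg_ext fun p => by
      rw [map_zero, ← hcon p p.2]
      exact (hf.pd hU _ p).symm)
  · rintro ⟨p, hp, hne⟩ h0
    refine hne ((hf.pd hU _ ⟨p, hp⟩).trans ?_)
    change ev _ ((smoothJetAlgebra hU).du (s, I) r) = 0
    rw [h0, map_zero]

theorem Represents.finite_orders (hf : Represents f r) : {k : ℤ | k = -1 ∨
    ∃ (s : Fin h) (I : Fin n → ℕ), k = (len I : ℤ) ∧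
      ∃ p ∈ U, GenEvolution.pd (.u s I) f p ≠ 0}.Finite := by
  refine ((((smoothJetAlgebra hU).finite_du r).image fun v => (len v.2 : ℤ)).insert (-1)).subset ?_
  rintro k (rfl | ⟨s, I, rfl, hp⟩)
  · exact Set.mem_insert _ _
  · exact Set.mem_insert_of_mem _ ⟨(s, I), (hf.du_ne_zero_iff hU s I).2 hp, rfl⟩

theorem Represents.len_le_order (hf : Represents f r) {s : Fin h} {I : Fin n → ℕ}
    (hne : (smoothJetAlgebra hU).du (s, I) r ≠ 0) : (len I : ℤ) ≤ order U f :=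
  le_csSup (hf.finite_orders hU).bddAbove
    (Or.inr ⟨s, I, rfl, (hf.du_ne_zero_iff hU s I).1 hne⟩)

theorem Represents.exists_du_ne_zero (hf : Represents f r) {k : ℕ} (hk : order U f = k) :
    ∃ (s : Fin h) (I : Fin n → ℕ), len I = k ∧ (smoothJetAlgebra hU).du (s, I) r ≠ 0 := by
  have key : ∀ S : Set ℤ, S.Finite → -1 ∈ S → sSup S ∈ S := fun S hS hmem =>
    Set.Nonempty.csSup_mem ⟨-1, hmem⟩ hS
  have hmem := key _ (hf.finite_orders hU) (Or.inl rfl)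
  change order U f = -1 ∨ _ at hmem
  rcases hmem with hmem | ⟨s, I, hI, hp⟩
  · omega
  · refine ⟨s, I, ?_, (hf.du_ne_zero_iff hU s I).2 hp⟩
    change order U f = _ at hI
    omega

end transfer

/-! ### The bound on the order of a characteristic -/

/-- Needed because `sSup` on `ℤ` is a meaningful upper bound only for sets bounded above. -/
theorem finite_boundO (hh : 0 < h) (U : Set (JetSpace n h)) (F : JetSpace n h → ℝ) (N : ℕ) :
    {k : ℤ | k = -1 ∨
      (∃ K : Fin n → ℕ, len K ≤ N ∧ k = order U (spaceCoeff hh F K) - N) ∨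
        ∃ s : ℕ, 1 ≤ s ∧ s < h ∧ k = order U (timeCoeff F s) - N}.Finite := by
  refine ((((finite_setOf_len_le N).image fun K => order U (spaceCoeff hh F K) - N).union
    ((Set.finite_Iio h).image fun s => order U (timeCoeff F s) - N)).insert (-1)).subset ?_
  rintro k (rfl | ⟨K, hK, rfl⟩ | ⟨s, -, hs, rfl⟩)
  · exact Set.mem_insert _ _
  · exact Set.mem_insert_of_mem _ (Or.inl ⟨K, hK, rfl⟩)
  · exact Set.mem_insert_of_mem _ (Or.inr ⟨s, hs, rfl⟩)

/-- The characteristic of a conserved current has order at most `boundO`. -/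
theorem order_characteristic_le (hh : 0 < h) {N : ℕ} (hN : 0 < N) {U : Set (JetSpace n h)}
    (hU : IsOpen U) {F : JetSpace n h → ℝ} (hF : SmoothOn U F)
    (hdep : ∀ (s : Fin h) (I : Fin n → ℕ), (s : ℕ) ≠ 0 → I ≠ 0 → ∀ p ∈ U, pd (.u s I) F p = 0)
    (hord : order U F = (N : ℤ)) (hsymb : U ⊆ closure (symbolNonzero hh U F N))
    (hodd : Odd (N + h)) {J : Fin (n + 1) → JetSpace n h → ℝ}
    (hJ : IsConservedCurrent U F J) : order U (characteristic hh J) ≤ boundO hh U F N := by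
  classical
  by_contra! hlt
  set A := smoothJetAlgebra hU
  set rF := hF.toAlg
  have hrF : Represents F rF := fun _ => rfl
  have hrJ : ∀ k, Represents (J k) (hJ.1 k).toAlg := fun _ _ => rfl
  set χ := A.adj ⟨h - 1, Nat.sub_one_lt_of_lt hh⟩ (hJ.1 0).toAlg 1
  have hrχ : Represents (characteristic hh J) χ := represents_characteristic hU hh (hrJ 0)
  have hbdd := (finite_boundO hh U F N).bddAbove
  have hneg : -1 ≤ boundO hh U F N := le_csSup hbdd (Or.inl rfl)
  -- The order exceeds `boundO ≥ -1`, so it is a natural number.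
  obtain ⟨k, hk⟩ : ∃ k : ℕ, order U (characteristic hh J) = k :=
    ⟨(order U (characteristic hh J)).toNat, by omega⟩
  have hF₀ : ∀ (s : Fin h) (I : Fin n → ℕ), N < len I → A.du (s, I) rF = 0 := by
    intro s I hI
    by_contra hne
    have := hrF.len_le_order hU hne
    omega
  have hF₁ : ∀ (s : Fin h) (I : Fin n → ℕ), 1 ≤ (s : ℕ) → 0 < len I → A.du (s, I) rF = 0 := by
    intro s I hs hI
    by_contra hne
    obtain ⟨p, hp, hne'⟩ := (hrF.du_ne_zero_iff hU s I).1 hne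
    refine hne' (hdep s I (by omega) ?_ p hp)
    rintro rfl
    simp [len_zero] at hI
  have hχ : ∀ (s : Fin h) (I : Fin n → ℕ), k < len I → A.du (s, I) χ = 0 := by
    intro s I hI
    by_contra hne
    have := hrχ.len_le_order hU hne
    omega
  obtain ⟨c, ⟨J₀, hJ₀, hcJ₀⟩, hc⟩ : ∃ c : Fin h, (∃ J₀, len J₀ = k ∧ A.du (c, J₀) χ ≠ 0) ∧
      ∀ s I, c < s → len I = k → A.du (s, I) χ = 0 := by
    obtain ⟨s, I, hI, hne⟩ := hrχ.exists_du_ne_zero hU hk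
    obtain ⟨c, hcmem, hcmax⟩ := Finset.exists_max_image
      (Finset.univ.filter fun s : Fin h => ∃ I, len I = k ∧ A.du (s, I) χ ≠ 0) id
      ⟨s, by simpa using ⟨I, hI, hne⟩⟩
    refine ⟨c, (Finset.mem_filter.1 hcmem).2, fun s I hs hI => ?_⟩
    by_contra hne
    exact absurd (hcmax s (by simpa using ⟨I, hI, hne⟩)) (not_le.2 hs)
  have hcons : A.Dt rF (hJ.1 0).toAlg + ∑ i : Fin n, A.Dx i (hJ.1 i.succ).toAlg = 0 := by
    refine smoothAlg_ext fun p => ?_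
    have := hJ.2 p p.2
    rw [Fin.sum_univ_succ] at this
    rw [map_add, map_sum, map_zero]
    refine Eq.trans ?_ this
    refine congrArg₂ _ (hrF.Dt hU (hrJ 0) p).symm (Finset.sum_congr rfl fun i _ => ?_)
    exact ((hrJ i.succ).Dx hU i p).symm
  have hadj := A.adjoint_equation hh rF _ _ hcons
  obtain ⟨B₀, hB₀⟩ := A.exists_multiIndex_support rF
  set B := B₀.filter fun I => len I ≤ N
  have hB : ∀ I ∉ B, A.du (⟨0, hh⟩, I) rF = 0 := by
    intro I hI
    by_cases hIN : N < len I
    · exact hF₀ _ I hIN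
    · exact hB₀ I (fun hI' => hI (Finset.mem_filter.2 ⟨hI', by omega⟩)) _
  have hBN : ∀ I ∈ B, len I ≤ N := fun I hI => (Finset.mem_filter.1 hI).2
  -- The index `0` is added by hand to hold the free term coming from the time derivatives, even
  -- when `B` is empty.
  set T := insert 0 (B.biUnion fun I => Finset.Iic I)
  have hBT : ∀ I ∈ B, Finset.Iic I ⊆ T := fun I hI =>
    (Finset.subset_biUnion_of_mem (fun I => Finset.Iic I) hI).trans (Finset.subset_insert _ _)
  have hTN : ∀ K ∈ T, len K ≤ N := by
    intro K hK
    rcases Finset.mem_insert.1 hK with rfl | hK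
    · simp [len_zero]
    · obtain ⟨I, hI, hKI⟩ := Finset.mem_biUnion.1 hK
      exact (len_mono (Finset.mem_Iic.1 hKI)).trans (hBN I hI)
  have hT : ∀ K ∉ T, len K = N → A.du (⟨0, hh⟩, K) rF = 0 := fun K hK _ =>
    hB K fun hKB => hK (hBT K hKB (Finset.mem_Iic.2 le_rfl))
  have hzero := fun {I} hI => A.symbol_mul_eq_zero (fun s I _ => hF₀ s I) hF₁ hχ hc hN hh hodd
    (A.adjoint_normal_form hh hF₁ hadj hB hBT (Finset.mem_insert_self _ _)) hTN hT
    (fun K hK => A.spaceCoeff_top hh hN hB hBN hK)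
    (fun K hK s I hI => by
      by_contra hne
      have h1 := (hrF.spaceCoeff hU hh K).len_le_order hU hne
      have h2 : order U (spaceCoeff hh F K) - N ≤ boundO hh U F N :=
        le_csSup hbdd (Or.inr (Or.inl ⟨K, hTN K hK, rfl⟩))
      omega)
    (fun j hj s I hI => by
      by_contra hne
      have h1 := (hrF.timeCoeff hU j).len_le_order hU hne
      have hj' := Finset.mem_Ico.1 hj
      have h2 : order U (timeCoeff F j) - N ≤ boundO hh U F N :=
        le_csSup hbdd (Or.inr (Or.inr ⟨j, hj'.1, hj'.2, rfl⟩))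
      omega) (I := I) hI
  obtain ⟨p₀, hp₀⟩ : ∃ p, ev p (A.du (c, J₀) χ) ≠ 0 := by
    by_contra! hcon
    exact hcJ₀ (smoothAlg_ext fun p => by rw [hcon p, map_zero])
  -- Density of the points with nonzero symbol gives one inside the open set where the chosen
  -- coefficient of `σ` is nonzero. Passing to a point is essential, since the ring of smooth
  -- functions may have zero divisors.
  obtain ⟨p, ⟨hp, hpχ⟩, -, K, hK, hpK⟩ := mem_closure_iff.1 (hsymb p₀.2) _
    (isOpen_ev_ne_zero hU (A.du (c, J₀) χ)) ⟨p₀.2, hp₀⟩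
  obtain ⟨I, hI, hne⟩ := exists_homogeneous_mul_ne_zero (N := N) (k := k)
    (a := fun K => ev ⟨p, hp⟩ (A.du (⟨0, hh⟩, K) rF)) (b := fun J => ev ⟨p, hp⟩ (A.du (c, J) χ))
    ⟨K, hK, fun h0 => hpK ((hrF.pd hU _ ⟨p, hp⟩).trans h0)⟩ ⟨J₀, hJ₀, hpχ⟩
  refine hne ?_
  have := congrArg (ev ⟨p, hp⟩) (hzero hI)
  rw [map_sum, map_zero] at this
  refine Eq.trans (Finset.sum_congr rfl fun K _ => ?_) this
  split_ifs <;> simp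

end GenEvolution

end

theorem theorem6 (n h N : ℕ) (hh : 0 < h) (hN : 0 < N)
    (U : Set (GenEvolution.JetSpace n h)) (hU : IsOpen U)
    (F : GenEvolution.JetSpace n h → ℝ) (hF : GenEvolution.SmoothOn U F)
    -- `F` depends on no mixed derivative `u_{s,I}` with `s ≠ 0` and `I ≠ 0`
    (hdep : ∀ (s : Fin h) (I : Fin n → ℕ), (s : ℕ) ≠ 0 → I ≠ 0 →
      ∀ p ∈ U, GenEvolution.pd (.u s I) F p = 0)
    (hord : GenEvolution.order U F = (N : ℤ))
    -- the symbol of `F` does not vanish identically on any nonempty open subset of `U`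
    (hsymb : U ⊆ closure (GenEvolution.symbolNonzero hh U F N))
    (hodd : Odd (N + h)) :
    ∀ C : Set (Fin (n + 1) → GenEvolution.JetSpace n h → ℝ),
      GenEvolution.IsConservationLaw U F C →
        ∀ k : ℤ, GenEvolution.LawHasOrder hh U C k → k ≤ GenEvolution.boundO hh U F N := by
  rintro C ⟨J, -, rfl⟩ k ⟨J', hJ', rfl⟩
  -- Every representative of the class is itself a conserved current, so the bound applies to it
  -- directly and no invariance under trivial currents is required.
  exact GenEvolution.order_characteristic_le hh hN hU hF hdep hord hsymb hodd hJ'.1
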